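/- **Setting.** Let $d\in\{2,3\}$, $T>0$, and let $\Omega\subset\mathbb R^d$ be a bounded connected Lipschitz domain that is a polygon ($d=2$) or polyhedron ($d=3$). Data: * the porosity $\varphi$ is piecewise constant in space, with $0<\varphi_{\min}\le\varphi\le\varphi_{\max}$ a.e. in $\Omega$; * the mobilities $\eta_w,\eta_o\ge 0$ are continuous on $[0,1]$, $\eta_w$ is nondecreasing, $\eta_o$ is nonincreasing, and $\eta_w+\eta_o\ge\eta_*$ on $[0,1]$ for some constant $\eta_*>0$; put $f_w=\eta_w/(\eta_w+\eta_o)$, $f_o=1-f_w$; * the capillary pressure $p_c$ is continuous and strictly decreasing on $[0,1]$ and belongs to $W^{1,1}(0,1)$; * $\bar q,\underline q\in L^2(\Omega\times]0,T[)$ satisfy $\bar q,\underline q\ge0$ a.e. and $\int_\Omega\bar q(t)=\int_\Omega\underline q(t)$ for a.e. $t$; * $0\le s_{\rm in}\le1$ a.e. in $\Omega\times]0,T[$ and $0\le s_w^0\le1$ a.e. in $\Omega$, both measurable. The functions $\eta_w,\eta_o,f_w,f_o,p_c$ are extended continuously to $\mathbb R$ by constants. **Meshes.** Let $\mathcal T_h$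 be a conforming mesh of $\overline\Omega$ by simplices, shape regular with constant $\sigma$ (the diameter of each simplex is at most $\sigma$ times the diameter of its largest inscribed ball), such that no angle of a triangle ($d=2$), respectively no dihedral angle of a tetrahedron ($d=3$), exceeds $\pi/2$, and such that $\varphi$ is constant on each element. Let $\boldsymbol x_1,\dots,\boldsymbol x_M$ be its nodes, $\phi_i$ the continuous piecewise affine function equal to $1$ at $\boldsymbol x_i$ and to $0$ at the other nodes, $\Delta_i$ the union of the elements that contain $\boldsymbol x_i$, and $$c_{ij}=\int_{\Delta_i\cap\Delta_j}|\nabla\phi_i\cdot\nabla\phi_j|,\qquad m_i=\frac{|\Delta_i|}{d+1},\qquad \tilde m_i=\frac1{d+1}\sum_{K\subset\Delta_i}\varphi|_K\,|K| .$$ For $g\in L^1(\Omega)$ let $r_h(g)=\sum_i r_h(g)^i\phi_i$ with $r_h(g)^i=|\Delta_i|^{-1}\int_{\Delta_i}g$. **Scheme.** Let $N\ge1$, $\tau=T/N$, $t_n=n\tau$. Put $S^{0,i}=r_h(s_w^0)^i$ and, for $1\le n\le N$, $$s_{\rm in}^{n,i}=\frac1\tau\int_{t_{n-1}}^{t_n}r_h(s_{\rm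 in})^i\,dt,\qquad \bar q^{n,i}=\frac1\tau\int_{t_{n-1}}^{t_n}\Big(r_h(\bar q)^i-\frac1{|\Omega|}\int_\Omega\big(r_h(\bar q)-\bar q\big)\Big)dt,$$ and define $\underline q^{n,i}$ likewise from $\underline q$. A discrete solution is a family of real numbers $S^{n,i},P_w^{n,i},P_o^{n,i}$ such that for all $1\le n\le N$ $$\frac{\tilde m_i}{\tau}(S^{n,i}-S^{n-1,i})-\sum_{j=1}^Mc_{ij}\,\eta_w(S_w^{n,ij})(P_w^{n,j}-P_w^{n,i})=m_i\big(f_w(s_{\rm in}^{n,i})\bar q^{n,i}-f_w(S^{n,i})\underline q^{n,i}\big),\quad 1\le i\le M-1,$$ $$-\frac{\tilde m_i}{\tau}(S^{n,i}-S^{n-1,i})-\sum_{j=1}^Mc_{ij}\,\eta_o(S_o^{n,ij})(P_o^{n,j}-P_o^{n,i})=m_i\big(f_o(s_{\rm in}^{n,i})\bar q^{n,i}-f_o(S^{n,i})\underline q^{n,i}\big),\quad 1\le i\le M,$$ $$P_o^{n,i}-P_w^{n,i}=p_c(S^{n,i}),\quad 1\le i\le M,\qquad \sum_{i=1}^Mm_iP_w^{n,i}=0,$$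 where, for $\alpha=w,o$, the upwind value $S_\alpha^{n,ij}$ is $S^{n,i}$ if $P_\alpha^{n,i}>P_\alpha^{n,j}$ and $S^{n,j}$ if $P_\alpha^{n,i}<P_\alpha^{n,j}$, while if $P_\alpha^{n,i}=P_\alpha^{n,j}$ it is $\max(S^{n,i},S^{n,j})$ for $\alpha=w$ and $\min(S^{n,i},S^{n,j})$ for $\alpha=o$. **Theorem.** There is a constant $C$, depending only on the data ($d$, $\Omega$, $T$, $\varphi$, $\eta_w$, $\eta_o$, $p_c$, $\bar q$, $\underline q$, $s_{\rm in}$, $s_w^0$) and on the shape regularity constant $\sigma$, and in particular independent of $h$ and $\tau$, such that for every such mesh, every $N\ge1$ and every discrete solution, $$\tau\sum_{n=1}^N\sum_{i,j=1}^Mc_{ij}\Big(\eta_w(S_w^{n,ij})\,(P_w^{n,i}-P_w^{n,j})^2+\eta_o(S_o^{n,ij})\,(P_o^{n,i}-P_o^{n,j})^2\Big)\le C.$$ -/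

import Mathlib

open MeasureTheory Set
open scoped ENNReal NNReal ContDiff InnerProductSpace

noncomputable section

namespace TwoPhase

/-- The space `ℝ^d` with its Euclidean norm and Lebesgue measure. -/
abbrev Pt (d : ℕ) : Type := EuclideanSpace ℝ (Fin d)

/-- `Ω` has a Lipschitz boundary: near each boundary point `x`, after a choice of a unit vector `ν`,
the set `Ω` is the part lying strictly above (in direction `ν`) the graph of a Lipschitz function
`γ` over the hyperplane through `x` orthogonal to `ν`.  (The point `y - ⟪ν, y - x⟫ ν` is the
orthogonal projection of `y` on that hyperplane; only the values of `γ` there matter.) -/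
def HasLipschitzBoundary {d : ℕ} (Ω : Set (Pt d)) : Prop :=
  ∀ x ∈ frontier Ω, ∃ (ν : Pt d) (r : ℝ) (L : ℝ≥0) (γ : Pt d → ℝ),
    ‖ν‖ = 1 ∧ 0 < r ∧ LipschitzWith L γ ∧
    ∀ y ∈ Metric.ball x r, (y ∈ Ω ↔ γ (y - ⟪ν, y - x⟫_ℝ • ν) < ⟪ν, y - x⟫_ℝ)

/-- The Sobolev space `W^{1,1}(0,1)`: `f` and a weak derivative `g` of `f` are integrable. -/
def MemW11 (f : ℝ → ℝ) : Prop :=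
  IntegrableOn f (Ioo 0 1) ∧ ∃ g : ℝ → ℝ, IntegrableOn g (Ioo 0 1) ∧
    ∀ ψ : ℝ → ℝ, ContDiff ℝ ∞ ψ → HasCompactSupport ψ → tsupport ψ ⊆ Ioo 0 1 →
      ∫ x in Ioo (0 : ℝ) 1, f x * deriv ψ x = - ∫ x in Ioo (0 : ℝ) 1, g x * ψ x

/-- Extension of a function on `[0,1]` to `ℝ` by the constants `f 0` and `f 1`. -/
def clampExt (f : ℝ → ℝ) (s : ℝ) : ℝ := f (max 0 (min s 1))

/-! ### Data of the continuous problem -/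

/-- The data of the two-phase flow problem.  Functions of time and space are written `f t x`.
The functions `ηw`, `ηo`, `pc` of the saturation are only meaningful on `[0,1]`. -/
structure Data (d : ℕ) where
  /-- the space domain -/
  Ω : Set (Pt d)
  /-- the final time -/
  T : ℝ
  /-- the porosity -/
  φ : Pt d → ℝ
  /-- the mobility of the wetting phase -/
  ηw : ℝ → ℝ
  /-- the mobility of the non-wetting phase -/
  ηo : ℝ → ℝ
  /-- the capillary pressure -/
  pc : ℝ → ℝ
  /-- the flow rate at the injection wells -/
  qIn : ℝ → Pt d → ℝ
  /-- the flow rate at the production wells -/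
  qOut : ℝ → Pt d → ℝ
  /-- the input saturation -/
  sIn : ℝ → Pt d → ℝ
  /-- the initial saturation -/
  s0 : Pt d → ℝ

namespace Data

variable {d : ℕ} (D : Data d)

/-- Fractional flow of the wetting phase, as a function on `[0,1]`. -/
def fw (s : ℝ) : ℝ := D.ηw s / (D.ηw s + D.ηo s)

/-- Fractional flow of the non-wetting phase, as a function on `[0,1]`. -/
def fo (s : ℝ) : ℝ := 1 - D.fw s

/-- Lebesgue measure on the space-time cylinder `]0,T[ × Ω`. -/
def cyl : Measure (ℝ × Pt d) :=
  (volume.restrict (Ioo 0 D.T)).prod (volume.restrict D.Ω)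

/-- The standing assumptions on the data. -/
structure Admissible : Prop where
  isOpen : IsOpen D.Ω
  isConnected : IsConnected D.Ω
  isBounded : Bornology.IsBounded D.Ω
  lipschitz : HasLipschitzBoundary D.Ω
  T_pos : 0 < D.T
  porosity : ∃ φmin φmax : ℝ, 0 < φmin ∧
    ∀ᵐ x ∂(volume.restrict D.Ω), φmin ≤ D.φ x ∧ D.φ x ≤ φmax
  ηw_nonneg : ∀ s ∈ Icc (0 : ℝ) 1, 0 ≤ D.ηw s
  ηw_cont : ContinuousOn D.ηw (Icc 0 1)
  ηw_mono : MonotoneOn D.ηw (Icc 0 1)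
  ηo_nonneg : ∀ s ∈ Icc (0 : ℝ) 1, 0 ≤ D.ηo s
  ηo_cont : ContinuousOn D.ηo (Icc 0 1)
  ηo_anti : AntitoneOn D.ηo (Icc 0 1)
  mobility_lower : ∃ ηstar : ℝ, 0 < ηstar ∧ ∀ s ∈ Icc (0 : ℝ) 1, ηstar ≤ D.ηw s + D.ηo s
  pc_cont : ContinuousOn D.pc (Icc 0 1)
  pc_strictAnti : StrictAntiOn D.pc (Icc 0 1)
  pc_W11 : MemW11 D.pc
  qIn_L2 : MemLp (fun p : ℝ × Pt d => D.qIn p.1 p.2) 2 D.cyl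
  qOut_L2 : MemLp (fun p : ℝ × Pt d => D.qOut p.1 p.2) 2 D.cyl
  qIn_nonneg : ∀ᵐ p ∂D.cyl, 0 ≤ D.qIn p.1 p.2
  qOut_nonneg : ∀ᵐ p ∂D.cyl, 0 ≤ D.qOut p.1 p.2
  q_balance : ∀ᵐ t ∂(volume.restrict (Ioo 0 D.T)),
    ∫ x in D.Ω, D.qIn t x = ∫ x in D.Ω, D.qOut t x
  sIn_meas : AEStronglyMeasurable (fun p : ℝ × Pt d => D.sIn p.1 p.2) D.cyl
  sIn_mem : ∀ᵐ p ∂D.cyl, D.sIn p.1 p.2 ∈ Icc (0 : ℝ) 1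
  s0_meas : AEStronglyMeasurable D.s0 (volume.restrict D.Ω)
  s0_mem : ∀ᵐ x ∂(volume.restrict D.Ω), D.s0 x ∈ Icc (0 : ℝ) 1

end Data

/-! ### Simplicial meshes and `P1` finite elements -/

/-- A conforming mesh of (the closure of) `Ω` by nondegenerate closed `d`-simplices.  Nodes are
indexed by `Fin M`, elements by `Fin L`, and `vert K a` is the global index of the `a`-th vertex
of element `K`. -/
structure Mesh (d : ℕ) (Ω : Set (Pt d)) where
  M : ℕ
  L : ℕ
  node : Fin M → Pt d
  vert : Fin L → Fin (d + 1) → Fin M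
  node_injective : Function.Injective node
  node_used : ∀ i, ∃ K, i ∈ range (vert K)
  indep : ∀ K, AffineIndependent ℝ (fun a => node (vert K a))
  vert_distinct : ∀ K K', range (vert K) = range (vert K') → K = K'
  conforming : ∀ K K',
    convexHull ℝ (node '' range (vert K)) ∩ convexHull ℝ (node '' range (vert K')) =
      convexHull ℝ (node '' (range (vert K) ∩ range (vert K')))
  covers : ⋃ K, convexHull ℝ (node '' range (vert K)) = closure Ω

namespace Mesh

variable {d : ℕ} {Ω : Set (Pt d)} (m : Mesh d Ω)

/-- The closed simplex with index `K`. -/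
def simplex (K : Fin m.L) : Set (Pt d) := convexHull ℝ (m.node '' range (m.vert K))

/-- The vertices of `K` as an affine basis of `ℝ^d`; its coordinates are the barycentric
coordinates of `K`. -/
def basis (K : Fin m.L) : AffineBasis (Fin (d + 1)) ℝ (Pt d) where
  toFun := fun a => m.node (m.vert K a)
  ind' := m.indep K
  tot' := (m.indep K).affineSpan_eq_top_iff_card_eq_finrank_add_one.2 (by simp)

/-- The elements having the node `i` as a vertex. -/
def star (i : Fin m.M) : Finset (Fin m.L) := by
  classical exact Finset.univ.filter fun K => i ∈ range (m.vert K)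

/-- The macro-element `Δ_i`: the union of the elements sharing the node `i`. -/
def patch (i : Fin m.M) : Set (Pt d) := ⋃ K ∈ m.star i, m.simplex K

/-- The affine function which takes the nodal values `U` at the vertices of `K`. -/
def localFun (U : Fin m.M → ℝ) (K : Fin m.L) (x : Pt d) : ℝ :=
  ∑ a, U (m.vert K a) * (m.basis K).coord a x

/-- The finite element function `∑ i, U i * φ_i` of `X_h` with nodal values `U`: on each element
it is `localFun U K` (by conformity, the choice of an element containing `x` is immaterial). -/
def feFun (U : Fin m.M → ℝ) (x : Pt d) : ℝ := by
  classical exact if h : ∃ K, x ∈ m.simplex K then m.localFun U h.choose x else 0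

/-- The restriction to `K` of the Lagrange basis function `φ_i`, extended as an affine function. -/
def hatOn (i : Fin m.M) (K : Fin m.L) : Pt d → ℝ := m.localFun (Pi.single i 1) K

/-- `c_ij`, the integral of `|∇φ_i · ∇φ_j|` over the elements sharing the nodes `i` and `j`. -/
def c (i j : Fin m.M) : ℝ :=
  ∑ K ∈ m.star i ∩ m.star j,
    ∫ x in m.simplex K, |⟪gradient (m.hatOn i K) x, gradient (m.hatOn j K) x⟫_ℝ|

/-- The lumped mass `m_i = |Δ_i| / (d+1)`. -/
def mass (i : Fin m.M) : ℝ := (1 / ((d : ℝ) + 1)) * ∑ K ∈ m.star i, volume.real (m.simplex K)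

/-- The weighted lumped mass `(1/(d+1)) ∑_{K ⊆ Δ_i} φ|_K |K|`.  Here `φ` is constant on each
element, and `φ|_K |K|` is written as the integral of `φ` over `K`. -/
def massW (φ : Pt d → ℝ) (i : Fin m.M) : ℝ :=
  (1 / ((d : ℝ) + 1)) * ∑ K ∈ m.star i, ∫ x in m.simplex K, φ x

/-- Nodal values of `r_h(g)`: the mean value of `g` on `Δ_i`. -/
def rh (g : Pt d → ℝ) (i : Fin m.M) : ℝ := ⨍ x in m.patch i, g x

/-- Nodal values of the corrected approximation
`r_h(g) - |Ω|⁻¹ ∫_Ω (r_h(g) - g)`. -/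
def rhCorr (g : Pt d → ℝ) (i : Fin m.M) : ℝ :=
  m.rh g i - (1 / volume.real Ω) * ∫ x in Ω, (m.feFun (m.rh g) x - g x)

/-- Shape regularity with constant `σ`: in each element there is a ball whose diameter is at least
`σ⁻¹` times the diameter of the element. -/
def ShapeRegular (σ : ℝ) : Prop :=
  ∀ K, ∃ (z : Pt d) (r : ℝ), 0 < r ∧ Metric.closedBall z r ⊆ m.simplex K ∧
    Metric.diam (m.simplex K) ≤ σ * (2 * r)

/-- Direction of the ridge of `K` spanned by all the vertices except those numbered `a` and `b`
(this ridge is a vertex if `d = 2` and an edge if `d = 3`). -/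
def ridgeDir (K : Fin m.L) (a b : Fin (d + 1)) : Submodule ℝ (Pt d) :=
  vectorSpan ℝ ((fun e => m.node (m.vert K e)) '' {a, b}ᶜ)

/-- No angle of the mesh exceeds `π/2`: in each element, the interior angle between any two facets
is at most `π/2`.  The facets opposite to the vertices `b` and `a` meet along the ridge spanned by
the other vertices; their angle is the one between the components orthogonal to the ridge of the
vectors that go from a point `e` of the ridge to `a` and to `b`.  For `d = 2` these are the usual
angles of the triangles, for `d = 3` the dihedral angles of the tetrahedra. -/
def NonObtuse : Prop :=
  ∀ (K : Fin m.L) (a b e : Fin (d + 1)), a ≠ b → e ≠ a → e ≠ b →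
    InnerProductGeometry.angle
      ((m.ridgeDir K a b)ᗮ.starProjection (m.node (m.vert K a) - m.node (m.vert K e)))
      ((m.ridgeDir K a b)ᗮ.starProjection (m.node (m.vert K b) - m.node (m.vert K e)))
      ≤ Real.pi / 2

/-- The function `φ` is (almost everywhere) constant on each element. -/
def ConstantOnElements (φ : Pt d → ℝ) : Prop :=
  ∀ K, ∃ k : ℝ, ∀ᵐ x ∂(volume.restrict (m.simplex K)), φ x = k

end Mesh

/-! ### The fully discrete scheme -/

/-- Time average `(1/τ) ∫_{(n-1)τ}^{nτ} f`. -/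
def timeMean (τ : ℝ) (f : ℝ → ℝ) (n : ℕ) : ℝ :=
  (1 / τ) * ∫ t in (((n : ℝ) - 1) * τ)..((n : ℝ) * τ), f t

/-- Upwind saturation of the wetting phase, from the nodal values at the nodes `i`, `j`. -/
def upwindW (Si Sj Pi Pj : ℝ) : ℝ :=
  if Pj < Pi then Si else if Pi < Pj then Sj else max Si Sj

/-- Upwind saturation of the non-wetting phase. -/
def upwindO (Si Sj Pi Pj : ℝ) : ℝ :=
  if Pj < Pi then Si else if Pi < Pj then Sj else min Si Sj

/-- `(S, Pw, Po)` (nodal values, first argument the time level) solves the upwind scheme with `N`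
time steps on the mesh `m`.  The wetting phase equation is only imposed at the nodes numbered
`1, …, M - 1`; the functions of the saturation are extended to `ℝ` by constants. -/
structure IsDiscreteSolution {d : ℕ} (D : Data d) (m : Mesh d D.Ω) (N : ℕ)
    (S Pw Po : ℕ → Fin m.M → ℝ) : Prop where
  init : ∀ i, S 0 i = m.rh D.s0 i
  wetting : ∀ n ∈ Finset.Icc 1 N, ∀ i : Fin m.M, (i : ℕ) + 1 < m.M →
    m.massW D.φ i / (D.T / N) * (S n i - S (n - 1) i)
      - ∑ j, m.c i j * clampExt D.ηw (upwindW (S n i) (S n j) (Pw n i) (Pw n j))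
          * (Pw n j - Pw n i)
    = m.mass i *
      (clampExt D.fw (timeMean (D.T / N) (fun t => m.rh (D.sIn t) i) n)
          * timeMean (D.T / N) (fun t => m.rhCorr (D.qIn t) i) n
        - clampExt D.fw (S n i) * timeMean (D.T / N) (fun t => m.rhCorr (D.qOut t) i) n)
  nonwetting : ∀ n ∈ Finset.Icc 1 N, ∀ i : Fin m.M,
    -(m.massW D.φ i / (D.T / N)) * (S n i - S (n - 1) i)
      - ∑ j, m.c i j * clampExt D.ηo (upwindO (S n i) (S n j) (Po n i) (Po n j))
          * (Po n j - Po n i)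
    = m.mass i *
      (clampExt D.fo (timeMean (D.T / N) (fun t => m.rh (D.sIn t) i) n)
          * timeMean (D.T / N) (fun t => m.rhCorr (D.qIn t) i) n
        - clampExt D.fo (S n i) * timeMean (D.T / N) (fun t => m.rhCorr (D.qOut t) i) n)
  capillary : ∀ n ∈ Finset.Icc 1 N, ∀ i, Po n i - Pw n i = clampExt D.pc (S n i)
  mean_zero : ∀ n ∈ Finset.Icc 1 N, ∑ i, m.mass i * Pw n i = 0

end TwoPhase

end

/-! Test the wetting equation with `Pw` and the non-wetting one with `Po`, and sum over the nodes.
Since the upwind coefficients are symmetric, summation by parts turns the fluxes into half of the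
sum E to be bounded. What remains is the accumulation times the capillary pressure, and the sources
times the pressures (`energy_identity`).

Accumulation. As p_c decreases, a primitive G of κ - p_c is convex, so (κ - p_c(S))(S - S') ≥ G(S) -
G(S'), and the right side telescopes in time (`exists_primitive_le`). With κ = p_c(1/2) and G(1/2) =
0, G is nonnegative on all of ℝ. An upper bound of G is needed only at the initial saturation, which
lies in [0,1] because it consists of mean values. The shift κ costs only a total source, since total
accumulation equals total source.

Sources. A phase pressure is not controlled where its mobility degenerates, but the global pressure
U = P_w + A(S), with dA = f_o dp_c, is. On each pair of nodes, η (U_i - U_j)² is at most the sum of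
the two upwind-weighted squares (`globalPressure_sq_le`), where η is a positive lower bound of the
total mobility. A is bounded, and the injected and produced totals agree, so a constant may be
subtracted from U. A Poincaré inequality and Young's inequality then absorb U into E
(`step_energy_le`).

Uniformity in the mesh. The Poincaré inequality is proved on Ω once, for functions whose translates
are controlled (`poincareOn_of_hasLipschitzBoundary`). Finite element functions satisfy this control
with their Dirichlet energy (`shiftBound_feFun`), and that energy is dominated by the c_ij-weighted
differences (`dirichlet_le`). Lumped and exact L² norms differ by at most a multiple of diam(Ω)²
times the energy. The discrete sources are averages in space and time, hence bounded by the L² norms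
of the data. -/

namespace TwoPhase

noncomputable section

variable {d : ℕ}

/-! ### A Poincaré inequality on Lipschitz domains -/

/-- A translation estimate: the squared `L²` norm of the increment of `u` by a vector `v` is at
most `‖v‖² E` on each set from which one can move along `v` without leaving `Ω`.  It is satisfied
by the functions whose gradient has squared `L²` norm at most `E`. -/
def ShiftBound (Ω : Set (Pt d)) (u : Pt d → ℝ) (E : ℝ≥0∞) : Prop :=
  ∀ (V : Set (Pt d)) (v : Pt d), MeasurableSet V →
    (∀ y ∈ V, ∀ t ∈ Icc (0 : ℝ) 1, y + t • v ∈ Ω) →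
    ∫⁻ y in V, ‖u (y + v) - u y‖ₑ ^ 2 ≤ ‖v‖ₑ ^ 2 * E

/-- The Poincaré inequality on the set `A` for the functions on `Ω`. -/
def PoincareOn (Ω A : Set (Pt d)) : Prop :=
  ∃ C : ℝ≥0∞, C ≠ ⊤ ∧ ∀ u : Pt d → ℝ, Measurable u → ∀ E, ShiftBound Ω u E →
    ∃ c : ℝ, ∫⁻ x in A, ‖u x - c‖ₑ ^ 2 ≤ C * E

theorem ennreal_add_sq_le (a b : ℝ≥0∞) : (a + b) ^ 2 ≤ 2 * (a ^ 2 + b ^ 2) := by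
  rcases eq_or_ne a ⊤ with rfl | ha
  · simp
  rcases eq_or_ne b ⊤ with rfl | hb
  · simp
  lift a to ℝ≥0 using ha
  lift b to ℝ≥0 using hb
  norm_cast
  rw [← NNReal.coe_le_coe]
  push_cast
  nlinarith [sq_nonneg ((a : ℝ) - b)]

theorem enorm_sub_sq_le (a b c : ℝ) : ‖a - c‖ₑ ^ 2 ≤ 2 * (‖a - b‖ₑ ^ 2 + ‖b - c‖ₑ ^ 2) := by
  refine le_trans ?_ (ennreal_add_sq_le _ _)
  gcongr
  rw [← sub_add_sub_cancel a b c]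
  exact enorm_add_le _ _

theorem lintegral_two_mul_add (A : Set (Pt d)) {f g : Pt d → ℝ≥0∞} (hf : Measurable f)
    (hg : Measurable g) :
    ∫⁻ x in A, 2 * (f x + g x) = 2 * ((∫⁻ x in A, f x) + ∫⁻ x in A, g x) := by
  rw [lintegral_const_mul 2 (show Measurable fun x => f x + g x from hf.add hg),
    lintegral_add_left hf]

theorem PoincareOn.mono {Ω A A' : Set (Pt d)} (h : PoincareOn Ω A) (hA : A' ⊆ A) :
    PoincareOn Ω A' := by
  obtain ⟨C, hC, H⟩ := h
  refine ⟨C, hC, fun u hu E hE => ?_⟩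
  obtain ⟨c, hc⟩ := H u hu E hE
  exact ⟨c, (lintegral_mono_set hA).trans hc⟩

/-- Integrate the squared difference of u(x) and u(y) over B × B, put y = x + v and exchange the
integrals. For fixed v, convexity keeps the segment from x to x + v in B, so the translation
estimate applies; only |v| < 2r contributes. -/
theorem poincareOn_ball {Ω : Set (Pt d)} {z : Pt d} {r : ℝ} (hr : 0 < r)
    (hB : Metric.ball z r ⊆ Ω) : PoincareOn Ω (Metric.ball z r) := by
  set B := Metric.ball z r with hBdef
  have hBm : MeasurableSet B := Metric.isOpen_ball.measurableSet
  have hB0 : volume B ≠ 0 := (Metric.measure_ball_pos _ _ hr).ne'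
  have hBt : volume B ≠ ⊤ := measure_ball_lt_top.ne
  set X : ℝ≥0∞ := volume (Metric.ball (0 : Pt d) (2 * r)) * ENNReal.ofReal (2 * r) ^ 2 with hX
  have hXt : X ≠ ⊤ := ENNReal.mul_ne_top measure_ball_lt_top.ne (by finiteness)
  refine ⟨X / volume B, ENNReal.div_ne_top hXt hB0, fun u hu E hE => ?_⟩
  set F : Pt d → Pt d → ℝ≥0∞ := fun x v =>
    B.indicator 1 x * (B.indicator 1 (v + x) * ‖u (v + x) - u x‖ₑ ^ 2) with hF
  have h1m : Measurable (B.indicator (1 : Pt d → ℝ≥0∞)) := measurable_one.indicator hBm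
  have hFm : Measurable (Function.uncurry F) := by
    have e : Function.uncurry F = fun p : Pt d × Pt d => B.indicator (1 : Pt d → ℝ≥0∞) p.1 *
      (B.indicator (1 : Pt d → ℝ≥0∞) (p.2 + p.1) * ‖u (p.2 + p.1) - u p.1‖ₑ ^ 2) := rfl
    rw [e]
    have hs : Measurable fun p : Pt d × Pt d => p.2 + p.1 := measurable_snd.add measurable_fst
    exact (h1m.comp measurable_fst).mul ((h1m.comp hs).mul
      ((((hu.comp hs).sub (hu.comp measurable_fst)).enorm).pow_const 2))
  have hinner : ∀ x ∈ B, ∫⁻ y in B, ‖u y - u x‖ₑ ^ 2 = ∫⁻ v, F x v := by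
    intro x hx
    rw [← lintegral_indicator hBm, ← lintegral_add_right_eq_self _ x]
    refine lintegral_congr fun v => ?_
    by_cases hv : v + x ∈ B <;> simp [hF, hx, hv]
  have hdouble : ∫⁻ x in B, ∫⁻ y in B, ‖u y - u x‖ₑ ^ 2 ≤ X * E := by
    rw [setLIntegral_congr_fun hBm hinner]
    refine (setLIntegral_le_lintegral _ _).trans ?_
    rw [lintegral_lintegral_swap hFm.aemeasurable]
    have hv : ∀ v, ∫⁻ x, F x v ≤
        (Metric.ball (0 : Pt d) (2 * r)).indicator (fun _ => ENNReal.ofReal (2 * r) ^ 2 * E) v := by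
      intro v
      set V : Set (Pt d) := B ∩ (fun x => v + x) ⁻¹' B with hV
      have hVm : MeasurableSet V := hBm.inter (measurable_const_add v hBm)
      have e : ∫⁻ x, F x v = ∫⁻ x in V, ‖u (x + v) - u x‖ₑ ^ 2 := by
        rw [← lintegral_indicator hVm]
        refine lintegral_congr fun x => ?_
        by_cases h1 : x ∈ B <;> by_cases h2 : v + x ∈ B <;> simp [hF, hV, h1, h2, add_comm x v]
      rw [e]
      by_cases hvr : v ∈ Metric.ball (0 : Pt d) (2 * r)
      · rw [indicator_of_mem hvr]
        refine (hE V v hVm fun y hy t ht => hB ?_).trans ?_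
        · simpa [hBdef] using (convex_ball z r).add_smul_sub_mem hy.1 hy.2 ht
        · gcongr
          rw [← ofReal_norm]
          exact ENNReal.ofReal_le_ofReal (mem_ball_zero_iff.1 hvr).le
      · have hVe : V = ∅ := by
          ext x
          simp only [hV, mem_inter_iff, mem_preimage, mem_empty_iff_false, iff_false, not_and]
          intro h1 h2
          apply hvr
          rw [hBdef, Metric.mem_ball] at h1 h2
          have := dist_triangle_right (v + x) x z
          rw [mem_ball_zero_iff]
          have e2 : dist (v + x) x = ‖v‖ := by simp [dist_eq_norm]
          linarith
        simp [hVe]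
    refine (lintegral_mono hv).trans ?_
    rw [lintegral_indicator Metric.isOpen_ball.measurableSet, setLIntegral_const, hX]
    exact le_of_eq (by ring)
  have hm : AEMeasurable (fun x => ∫⁻ y in B, ‖u y - u x‖ₑ ^ 2) (volume.restrict B) := by
    have : Measurable (Function.uncurry fun x y : Pt d => ‖u y - u x‖ₑ ^ 2) := by
      have h1 : Measurable fun p : Pt d × Pt d => u p.2 - u p.1 :=
        (hu.comp measurable_snd).sub (hu.comp measurable_fst)
      exact h1.enorm.pow_const 2
    exact (Measurable.lintegral_prod_right this).aemeasurable
  -- Some x has an inner integral no larger than the average over B; its value u(x) serves as the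
  -- constant.
  obtain ⟨x, hx, hle⟩ := exists_le_setLAverage hB0 hBt hm
  refine ⟨u x, hle.trans ?_⟩
  rw [setLAverage_eq, ENNReal.div_eq_inv_mul, ENNReal.div_eq_inv_mul, mul_assoc]
  gcongr

/-- The constants c and c' attached to the two sets are compared on the overlap: its positive
measure times |c' - c|² is bounded by the two integrals, so c can replace c' on A'. -/
theorem PoincareOn.union {Ω A A' : Set (Pt d)} (h : PoincareOn Ω A) (h' : PoincareOn Ω A')
    (h0 : volume (A ∩ A') ≠ 0) (ht : volume A' ≠ ⊤) :
    PoincareOn Ω (A ∪ A') := by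
  obtain ⟨C, hC, H⟩ := h
  obtain ⟨C', hC', H'⟩ := h'
  have hI : volume (A ∩ A') ≠ ⊤ := ne_top_of_le_ne_top ht (measure_mono inter_subset_right)
  refine ⟨C + 2 * (C' + volume A' * ((volume (A ∩ A'))⁻¹ * (2 * (C + C')))), ?_,
    fun u hu E hE => ?_⟩
  · have : (volume (A ∩ A'))⁻¹ ≠ ⊤ := ENNReal.inv_ne_top.2 h0
    finiteness
  obtain ⟨c, hc⟩ := H u hu E hE
  obtain ⟨c', hc'⟩ := H' u hu E hE
  refine ⟨c, ?_⟩
  have hmeas : ∀ a : ℝ, Measurable fun x => ‖u x - a‖ₑ ^ 2 := fun a =>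
    (hu.sub_const a).enorm.pow_const 2
  have hcc : ‖c' - c‖ₑ ^ 2 ≤ (volume (A ∩ A'))⁻¹ * (2 * (C + C') * E) := by
    rw [← ENNReal.mul_le_iff_le_inv h0 hI]
    calc volume (A ∩ A') * ‖c' - c‖ₑ ^ 2 = ∫⁻ x in A ∩ A', ‖c' - c‖ₑ ^ 2 := by
          rw [setLIntegral_const, mul_comm]
      _ ≤ ∫⁻ x in A ∩ A', 2 * (‖u x - c‖ₑ ^ 2 + ‖u x - c'‖ₑ ^ 2) := by
          refine lintegral_mono fun x => ?_
          rw [add_comm, ← enorm_neg (u x - c'), neg_sub]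
          exact enorm_sub_sq_le _ _ _
      _ = 2 * ((∫⁻ x in A ∩ A', ‖u x - c‖ₑ ^ 2) + ∫⁻ x in A ∩ A', ‖u x - c'‖ₑ ^ 2) :=
          lintegral_two_mul_add _ (hmeas c) (hmeas c')
      _ ≤ 2 * (C * E + C' * E) := by
          gcongr
          · exact (lintegral_mono_set inter_subset_left).trans hc
          · exact (lintegral_mono_set inter_subset_right).trans hc'
      _ = 2 * (C + C') * E := by ring
  calc ∫⁻ x in A ∪ A', ‖u x - c‖ₑ ^ 2
      ≤ (∫⁻ x in A, ‖u x - c‖ₑ ^ 2) + ∫⁻ x in A', ‖u x - c‖ₑ ^ 2 := lintegral_union_le _ _ _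
    _ ≤ C * E + ∫⁻ x in A', 2 * (‖u x - c'‖ₑ ^ 2 + ‖c' - c‖ₑ ^ 2) := by
        gcongr
        exact enorm_sub_sq_le _ _ _
    _ = C * E + 2 * ((∫⁻ x in A', ‖u x - c'‖ₑ ^ 2) + ‖c' - c‖ₑ ^ 2 * volume A') := by
        rw [lintegral_two_mul_add _ (hmeas c') measurable_const, setLIntegral_const]
    _ ≤ C * E + 2 * (C' * E + (volume (A ∩ A'))⁻¹ * (2 * (C + C') * E) * volume A') := by
        gcongr
    _ = (C + 2 * (C' + volume A' * ((volume (A ∩ A'))⁻¹ * (2 * (C + C'))))) * E := by ring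

/-- On V, compare u(x) with u(x + v), whose argument lies in A. The same constant then works on V,
at the price ‖v‖² E. This is how the inequality reaches the boundary. -/
theorem PoincareOn.union_of_shift {Ω A V : Set (Pt d)} (h : PoincareOn Ω A)
    (hA : MeasurableSet A) (hV : MeasurableSet V) (v : Pt d)
    (hΩ : ∀ y ∈ V, ∀ t ∈ Icc (0 : ℝ) 1, y + t • v ∈ Ω) (hVA : ∀ y ∈ V, y + v ∈ A) :
    PoincareOn Ω (A ∪ V) := by
  obtain ⟨C, hC, H⟩ := h
  refine ⟨C + 2 * (‖v‖ₑ ^ 2 + C), by finiteness, fun u hu E hE => ?_⟩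
  obtain ⟨c, hc⟩ := H u hu E hE
  refine ⟨c, ?_⟩
  have hmeas : Measurable fun x => ‖u x - c‖ₑ ^ 2 := (hu.sub_const c).enorm.pow_const 2
  have hsm : Measurable fun x : Pt d => x + v := measurable_add_const v
  calc ∫⁻ x in A ∪ V, ‖u x - c‖ₑ ^ 2
      ≤ (∫⁻ x in A, ‖u x - c‖ₑ ^ 2) + ∫⁻ x in V, ‖u x - c‖ₑ ^ 2 := lintegral_union_le _ _ _
    _ ≤ C * E + ∫⁻ x in V, 2 * (‖u (x + v) - u x‖ₑ ^ 2 + ‖u (x + v) - c‖ₑ ^ 2) := by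
        gcongr with x
        rw [← enorm_neg (u (x + v) - u x), neg_sub]
        exact enorm_sub_sq_le _ _ _
    _ = C * E + 2 * ((∫⁻ x in V, ‖u (x + v) - u x‖ₑ ^ 2) + ∫⁻ x in V, ‖u (x + v) - c‖ₑ ^ 2) := by
        have h1 : Measurable fun x => ‖u (x + v) - u x‖ₑ ^ 2 :=
          ((hu.comp hsm).sub hu).enorm.pow_const 2
        rw [lintegral_two_mul_add _ h1 (g := fun x => ‖u (x + v) - c‖ₑ ^ 2) (hmeas.comp hsm)]
    _ ≤ C * E + 2 * (‖v‖ₑ ^ 2 * E + C * E) := by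
        gcongr
        · exact hE V v hV hΩ
        · refine le_trans ?_ hc
          rw [← lintegral_indicator hV, ← lintegral_indicator hA,
            ← lintegral_add_right_eq_self (A.indicator _) v]
          refine lintegral_mono fun x => ?_
          by_cases hx : x ∈ V
          · simp [hx, hVA x hx]
          · simp [hx]
    _ = (C + 2 * (‖v‖ₑ ^ 2 + C)) * E := by ring

/-- A point of the boundary lies on the graph of which the domain is locally the epigraph. -/
theorem graph_eq_of_mem_frontier {Ω : Set (Pt d)} (hO : IsOpen Ω) {x ν : Pt d} {r : ℝ} {L : ℝ≥0}
    {γ : Pt d → ℝ} (hγ : LipschitzWith L γ)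
    (H : ∀ y ∈ Metric.ball x r, (y ∈ Ω ↔ γ (y - ⟪ν, y - x⟫_ℝ • ν) < ⟪ν, y - x⟫_ℝ))
    {y : Pt d} (hy : y ∈ frontier Ω) (hyr : y ∈ Metric.ball x r) :
    γ (y - ⟪ν, y - x⟫_ℝ • ν) = ⟪ν, y - x⟫_ℝ := by
  have hcont : Continuous fun y => γ (y - ⟪ν, y - x⟫_ℝ • ν) := hγ.continuous.comp (by fun_prop)
  rw [hO.frontier_eq] at hy
  refine le_antisymm ?_ (not_lt.1 fun h => hy.2 ((H y hyr).2 h))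
  have hcl : y ∈ closure (Metric.ball x r ∩ Ω) :=
    closure_mono (by rw [inter_comm]) (Metric.isOpen_ball.inter_closure ⟨hyr, hy.1⟩)
  have hsub : closure (Metric.ball x r ∩ Ω) ⊆
      {y | γ (y - ⟪ν, y - x⟫_ℝ • ν) ≤ ⟪ν, y - x⟫_ℝ} :=
    closure_minimal (fun z hz => ((H z hz.1).1 hz.2).le) (isClosed_le hcont (by fun_prop))
  exact hsub hcl

/-- Locally the boundary lies in a graph over the hyperplane orthogonal to ν. The translates of the
graph by ν/(n+1) are pairwise disjoint and the translation vectors are bounded, which forces measure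
zero. -/
theorem volume_frontier_eq_zero {Ω : Set (Pt d)} (hO : IsOpen Ω) (hl : HasLipschitzBoundary Ω) :
    volume (frontier Ω) = 0 := by
  refine measure_null_of_locally_null _ fun x hx => ?_
  obtain ⟨ν, r, L, γ, hν, hr, hγ, H⟩ := hl x hx
  refine ⟨frontier Ω ∩ Metric.ball x r,
    inter_mem_nhdsWithin _ (Metric.ball_mem_nhds x hr), ?_⟩
  have hcont : Continuous fun y => γ (y - ⟪ν, y - x⟫_ℝ • ν) := hγ.continuous.comp (by fun_prop)
  have hνν : ⟪ν, ν⟫_ℝ = 1 := by rw [real_inner_self_eq_norm_sq, hν]; norm_num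
  refine measure_mono_null
    (t := {y : Pt d | γ (y - ⟪ν, y - x⟫_ℝ • ν) = ⟪ν, y - x⟫_ℝ}) ?_ ?_
  · exact fun y hy => graph_eq_of_mem_frontier hO hγ H hy.1 hy.2
  · refine Measure.addHaar_eq_zero_of_disjoint_translates _
      (fun n : ℕ => ((1 : ℝ) / (n + 1)) • ν) ?_ ?_ ?_
    · refine (Metric.isBounded_closedBall (x := (0 : Pt d)) (r := 1)).subset ?_
      rintro _ ⟨n, rfl⟩
      rw [mem_closedBall_zero_iff, norm_smul, hν, mul_one, Real.norm_eq_abs,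
        abs_of_nonneg (by positivity), div_le_one (by positivity)]
      linarith [(Nat.cast_nonneg n : (0 : ℝ) ≤ n)]
    · intro n k hnk
      rw [Function.onFun, Set.disjoint_left]
      rintro z ⟨_, rfl, y, hy, rfl⟩ ⟨_, rfl, y', hy', h⟩
      apply hnk
      simp only [mem_ofPred_eq] at hy hy'
      set a : ℝ := 1 / ((n : ℝ) + 1) with ha
      set b : ℝ := 1 / ((k : ℝ) + 1) with hb
      have h' : y' = y + (a - b) • ν := by
        simp only at h
        rw [sub_smul]
        rw [← sub_eq_zero] at h ⊢
        rw [← h]; abel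
      have hin : ⟪ν, y' - x⟫_ℝ = ⟪ν, y - x⟫_ℝ + (a - b) := by
        rw [h', add_sub_right_comm, inner_add_right, inner_smul_right, hνν, mul_one]
      have hp : y' - ⟪ν, y' - x⟫_ℝ • ν = y - ⟪ν, y - x⟫_ℝ • ν := by
        rw [hin, h', add_smul]; abel
      rw [hp, hin, hy] at hy'
      have hab : a = b := by linarith
      rw [ha, hb] at hab
      have h2 : (n : ℝ) + 1 = k + 1 := by
        simpa using hab
      exact_mod_cast (add_right_cancel h2)
    · exact (isClosed_eq hcont (by fun_prop)).measurableSet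

/-- Near a point of the boundary, one enters a given small ball contained in the domain by a
translation. -/
theorem exists_shift_of_mem_frontier {Ω : Set (Pt d)} (hO : IsOpen Ω)
    (hl : HasLipschitzBoundary Ω) {x : Pt d} (hx : x ∈ frontier Ω) :
    ∃ v : Pt d, x + v ∈ Ω ∧ ∃ ρ > 0, ∀ y ∈ Metric.ball x ρ ∩ Ω, ∀ t ∈ Icc (0 : ℝ) 1,
      y + t • v ∈ Ω := by
  obtain ⟨ν, r, L, γ, hν, hr, hγ, H⟩ := hl x hx
  have hνν : ⟪ν, ν⟫_ℝ = 1 := by rw [real_inner_self_eq_norm_sq, hν]; norm_num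
  have key : ∀ (y : Pt d) (t : ℝ), ⟪ν, y + t • ν - x⟫_ℝ = ⟪ν, y - x⟫_ℝ + t := fun y t => by
    rw [add_sub_right_comm, inner_add_right, inner_smul_right, hνν, mul_one]
  have keyp : ∀ (y : Pt d) (t : ℝ),
      y + t • ν - ⟪ν, y + t • ν - x⟫_ℝ • ν = y - ⟪ν, y - x⟫_ℝ • ν := fun y t => by
    rw [key, add_smul]; abel
  have hball : ∀ (y : Pt d) (t : ℝ), y ∈ Metric.ball x (r / 2) → t ∈ Icc (0 : ℝ) (r / 4) →
      y + t • ν ∈ Metric.ball x r := by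
    intro y t hy ht
    rw [Metric.mem_ball] at hy ⊢
    have h1 := dist_triangle (y + t • ν) y x
    have h2 : dist (y + t • ν) y = t := by
      simp [dist_eq_norm, norm_smul, hν, abs_of_nonneg ht.1]
    linarith [ht.2]
  have hxx := graph_eq_of_mem_frontier hO hγ H hx (Metric.mem_ball_self hr)
  -- With y within r/2 of x and a displacement of at most r/4, the whole segment stays in the ball
  -- of radius r where Ω is an epigraph; moving along ν goes upwards.
  refine ⟨(r / 4) • ν, ?_, r / 2, by positivity, ?_⟩
  · rw [H _ (hball x _ (Metric.mem_ball_self (by positivity)) ⟨by positivity, le_rfl⟩), keyp, key,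
      hxx]
    linarith
  · rintro y ⟨hy, hyΩ⟩ t ht
    rw [smul_smul]
    have hyr : y ∈ Metric.ball x r := Metric.ball_subset_ball (by linarith) hy
    have h0 : 0 ≤ t * (r / 4) := mul_nonneg ht.1 (by positivity)
    rw [H _ (hball y _ hy ⟨h0, by nlinarith [ht.2]⟩), keyp, key]
    linarith [(H y hyr).1 hyΩ]

/-- The Poincaré inequality on a bounded connected Lipschitz domain. -/
theorem poincareOn_of_hasLipschitzBoundary {Ω : Set (Pt d)} (hO : IsOpen Ω) (hc : IsConnected Ω)
    (hb : Bornology.IsBounded Ω) (hl : HasLipschitzBoundary Ω) : PoincareOn Ω Ω := by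
  obtain ⟨z, hz⟩ := hc.nonempty
  obtain ⟨r, hr, hB⟩ := Metric.isOpen_iff.1 hO z hz
  set B := Metric.ball z r with hBdef
  have hBm : MeasurableSet B := Metric.isOpen_ball.measurableSet
  have hB0 : volume B ≠ 0 := (Metric.measure_ball_pos _ _ hr).ne'
  have hBt : volume B ≠ ⊤ := measure_ball_lt_top.ne
  have hΩt : volume Ω ≠ ⊤ := hb.measure_lt_top.ne
  -- Connectedness: the points having a ball that can be joined to the fixed ball B form a nonempty,
  -- open and relatively closed subset of Ω.
  have hBall : ∀ x ∈ Ω, ∃ ε > 0, Metric.ball x ε ⊆ Ω ∧ PoincareOn Ω (Metric.ball x ε ∪ B) := by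
    have hsub : Ω ⊆ {x | ∃ ε > 0, Metric.ball x ε ⊆ Ω ∧ PoincareOn Ω (Metric.ball x ε ∪ B)} := by
      refine hc.isPreconnected.subset_of_closure_inter_subset ?_ ?_ ?_
      · rw [Metric.isOpen_iff]
        rintro x ⟨ε, hε, h1, h2⟩
        refine ⟨ε, hε, fun y hy => ⟨ε - dist y x, by simpa using hy, ?_⟩⟩
        have : Metric.ball y (ε - dist y x) ⊆ Metric.ball x ε := Metric.ball_subset_ball' (by simp)
        exact ⟨this.trans h1, h2.mono (union_subset_union_left _ this)⟩
      · exact ⟨z, hz, r, hr, hB, by simpa [hBdef] using poincareOn_ball hr hB⟩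
      · rintro x ⟨hxc, hxΩ⟩
        obtain ⟨ρ, hρ, hρΩ⟩ := Metric.isOpen_iff.1 hO x hxΩ
        obtain ⟨y, ⟨ε, hε, h1, h2⟩, hyx⟩ := Metric.mem_closure_iff.1 hxc ρ hρ
        refine ⟨ρ, hρ, hρΩ, (h2.union (poincareOn_ball hρ hρΩ) ?_ measure_ball_lt_top.ne).mono ?_⟩
        -- The balls around x and y overlap in an open set containing y, hence in positive measure.
        · refine ne_of_gt (lt_of_lt_of_le ?_ (measure_mono (inter_subset_inter_left _
            subset_union_left)))
          refine (Metric.isOpen_ball.inter Metric.isOpen_ball).measure_pos _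
            ⟨y, Metric.mem_ball_self hε, ?_⟩
          rwa [Metric.mem_ball, dist_comm]
        · exact union_subset subset_union_right (subset_union_right.trans subset_union_left)
    exact hsub
  have hcompact : IsCompact (closure Ω) := hb.isCompact_closure
  -- Compactness of the closure reduces the claim to neighbourhoods of its points. Adjoining B to
  -- every set gives any two of them an overlap of positive measure.
  have hfinal : PoincareOn Ω (closure Ω ∩ Ω ∪ B) := by
    refine hcompact.induction_on (p := fun s => PoincareOn Ω (s ∩ Ω ∪ B)) ?_ ?_ ?_ ?_
    · simpa using poincareOn_ball hr hB
    · exact fun s t hst h => h.mono (union_subset_union_left _ (inter_subset_inter_left _ hst))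
    · intro s t hs ht
      refine (hs.union ht ?_ ?_).mono ?_
      · exact ne_of_gt (lt_of_lt_of_le (pos_iff_ne_zero.2 hB0) (measure_mono
          (subset_inter subset_union_right subset_union_right)))
      · exact ne_top_of_le_ne_top hΩt (measure_mono (union_subset inter_subset_right hB))
      · rw [union_inter_distrib_right]
        exact union_subset (union_subset_union subset_union_left subset_union_left)
          (subset_union_right.trans subset_union_left)
    · intro x hx
      by_cases hxΩ : x ∈ Ω
      · obtain ⟨ε, hε, -, h2⟩ := hBall x hxΩ
        exact ⟨Metric.ball x ε, mem_nhdsWithin_of_mem_nhds (Metric.ball_mem_nhds x hε),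
          h2.mono (union_subset_union_left _ inter_subset_left)⟩
      -- A boundary point is shifted to the interior point x + v, where a good ball is already
      -- known; the part of Ω near x is carried into that ball.
      · obtain ⟨v, hv, ρ, hρ, hs⟩ := exists_shift_of_mem_frontier hO hl
          (hO.frontier_eq ▸ ⟨hx, hxΩ⟩ : x ∈ frontier Ω)
        obtain ⟨ε, hε, -, h2⟩ := hBall _ hv
        refine ⟨Metric.ball x (min ρ ε), mem_nhdsWithin_of_mem_nhds
          (Metric.ball_mem_nhds x (lt_min hρ hε)), ?_⟩
        refine (h2.union_of_shift (Metric.isOpen_ball.measurableSet.union hBm)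
          (Metric.isOpen_ball.inter hO).measurableSet v
          (V := Metric.ball x (min ρ ε) ∩ Ω) ?_ ?_).mono ?_
        · exact fun y hy => hs y ⟨Metric.ball_subset_ball (min_le_left _ _) hy.1, hy.2⟩
        · rintro y ⟨hy, -⟩
          left
          rw [Metric.mem_ball, dist_add_right]
          exact lt_of_lt_of_le hy (min_le_right _ _)
        · exact union_subset subset_union_right (subset_union_right.trans subset_union_left)
  exact hfinal.mono fun x hx => Or.inl ⟨subset_closure hx, hx⟩

/-! ### Affine functions -/

theorem affineMap_hasGradientAt {d : ℕ} (f : Pt d →ᵃ[ℝ] ℝ) :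
    ∃ g : Pt d, (∀ x, gradient f x = g) ∧ ∀ x y, f x - f y = ⟪g, x - y⟫_ℝ := by
  set l : Pt d →L[ℝ] ℝ := LinearMap.toContinuousLinearMap f.linear with hl
  have hdec : ∀ x, f x = l x + f 0 := fun x => by
    simpa [hl] using congrFun f.decomp x
  refine ⟨(InnerProductSpace.toDual ℝ (Pt d)).symm l, fun x => ?_, fun x y => ?_⟩
  · have h : HasFDerivAt f l x := by
      have h1 : HasFDerivAt (fun x => l x + f 0) l x := l.hasFDerivAt.add_const _
      exact h1.congr_of_eventuallyEq (Filter.Eventually.of_forall hdec)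
    rw [gradient, h.fderiv]
  · rw [InnerProductSpace.toDual_symm_apply, map_sub, hdec x, hdec y]
    ring

/-! ### Measure of elements and patches, and assembly of sums element by element. -/

namespace Mesh

variable {d : ℕ} {Ω : Set (Pt d)} (m : Mesh d Ω)

theorem vert_injective (K : Fin m.L) : Function.Injective (m.vert K) := fun _ _ h =>
  (m.indep K).injective (congrArg m.node h)

theorem basis_apply (K : Fin m.L) (a : Fin (d + 1)) : m.basis K a = m.node (m.vert K a) := rfl

theorem mem_star {i : Fin m.M} {K : Fin m.L} : K ∈ m.star i ↔ ∃ a, m.vert K a = i := by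
  simp [star]

theorem simplex_eq (K : Fin m.L) : m.simplex K = convexHull ℝ (range (m.basis K)) := by
  rw [simplex, ← range_comp]
  rfl

theorem isCompact_simplex (K : Fin m.L) : IsCompact (m.simplex K) := by
  rw [simplex_eq]
  exact (finite_range _).isCompact_convexHull ℝ

theorem measurableSet_simplex (K : Fin m.L) : MeasurableSet (m.simplex K) :=
  (m.isCompact_simplex K).isClosed.measurableSet

theorem volume_simplex_ne_top (K : Fin m.L) : volume (m.simplex K) ≠ ⊤ :=
  (m.isCompact_simplex K).measure_lt_top.ne

theorem node_mem_simplex (K : Fin m.L) (a : Fin (d + 1)) :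
    m.node (m.vert K a) ∈ m.simplex K :=
  subset_convexHull _ _ ⟨_, mem_range_self a, rfl⟩

theorem volume_simplex_pos (K : Fin m.L) : 0 < volume.real (m.simplex K) := by
  refine ENNReal.toReal_pos (ne_of_gt ?_) (m.volume_simplex_ne_top K)
  refine MeasureTheory.Measure.measure_pos_of_nonempty_interior _ ?_
  rw [simplex_eq]
  exact ⟨_, (m.basis K).centroid_mem_interior_convexHull⟩

theorem iUnion_simplex : ⋃ K, m.simplex K = closure Ω := m.covers

theorem simplex_subset (K : Fin m.L) : m.simplex K ⊆ closure Ω := by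
  rw [← m.iUnion_simplex]
  exact subset_iUnion _ K

/-- Some vertex a of K is not a vertex of K'. By conformity the intersection lies in the affine span
of vertices of K other than a, a proper affine subspace, hence null. -/
theorem aedisjoint_simplex {K K' : Fin m.L} (h : K ≠ K') :
    AEDisjoint volume (m.simplex K) (m.simplex K') := by
  have hne : ¬ range (m.vert K) ⊆ range (m.vert K') := by
    intro hsub
    refine h (m.vert_distinct _ _ (Set.eq_of_subset_of_ncard_le hsub ?_))
    rw [← image_univ, ← image_univ, ncard_image_of_injective _ (m.vert_injective K),
      ncard_image_of_injective _ (m.vert_injective K')]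
  obtain ⟨_, ⟨a, rfl⟩, ha⟩ := not_subset.1 hne
  have hconf : m.simplex K ∩ m.simplex K' =
      convexHull ℝ (m.node '' (range (m.vert K) ∩ range (m.vert K'))) := m.conforming K K'
  rw [AEDisjoint, hconf]
  set s : Set (Fin (d + 1)) := {b | m.vert K b ∈ range (m.vert K')}
  have himg : m.node '' (range (m.vert K) ∩ range (m.vert K')) = m.basis K '' s := by
    ext x
    constructor
    · rintro ⟨_, ⟨⟨b, rfl⟩, hb⟩, rfl⟩
      exact ⟨b, hb, rfl⟩
    · rintro ⟨b, hb, rfl⟩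
      exact ⟨_, ⟨⟨b, rfl⟩, hb⟩, rfl⟩
  rw [himg]
  refine measure_mono_null (convexHull_subset_affineSpan _)
    (Measure.addHaar_affineSubspace volume _ fun htop => ha ?_)
  have := ((m.basis K).ind.mem_affineSpan_iff a s).1 (htop ▸ AffineSubspace.mem_top ℝ (Pt d) _)
  exact this

theorem restrict_biUnion_simplex (s : Finset (Fin m.L)) :
    volume.restrict (⋃ K ∈ s, m.simplex K) = ∑ K ∈ s, volume.restrict (m.simplex K) := by
  have e : (⋃ K ∈ s, m.simplex K) = ⋃ K : s, m.simplex K := by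
    ext x; simp
  rw [e, Measure.restrict_iUnion_ae, Measure.sum_fintype,
    Finset.sum_coe_sort s fun K => volume.restrict (m.simplex K)]
  · exact fun K K' h => m.aedisjoint_simplex fun h' => h (Subtype.ext h')
  · exact fun K => (m.measurableSet_simplex K).nullMeasurableSet

theorem restrict_closure_eq (hΩ : volume (frontier Ω) = 0) :
    volume.restrict (closure Ω) = volume.restrict Ω :=
  (Measure.restrict_congr_set (closure_ae_eq_of_null_frontier hΩ))

theorem restrict_eq_sum (hΩ : volume (frontier Ω) = 0) :
    volume.restrict Ω = ∑ K, volume.restrict (m.simplex K) := by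
  rw [← restrict_closure_eq hΩ, ← m.iUnion_simplex, ← m.restrict_biUnion_simplex]
  simp

theorem integral_eq_sum (hΩ : volume (frontier Ω) = 0) {f : Pt d → ℝ}
    (hf : ∀ K, IntegrableOn f (m.simplex K)) :
    ∫ x in Ω, f x = ∑ K, ∫ x in m.simplex K, f x := by
  rw [m.restrict_eq_sum hΩ, integral_finsetSum_measure fun K _ => hf K]

theorem lintegral_eq_sum (hΩ : volume (frontier Ω) = 0) (f : Pt d → ℝ≥0∞) :
    ∫⁻ x in Ω, f x = ∑ K, ∫⁻ x in m.simplex K, f x := by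
  rw [m.restrict_eq_sum hΩ, lintegral_finsetSum_measure]

theorem integrableOn_simplex (hΩ : volume (frontier Ω) = 0) {f : Pt d → ℝ}
    (hf : IntegrableOn f Ω) (K : Fin m.L) : IntegrableOn f (m.simplex K) := by
  rw [IntegrableOn, ← restrict_closure_eq hΩ] at hf
  exact IntegrableOn.mono_set hf (m.simplex_subset K)

theorem integral_patch {f : Pt d → ℝ} (hf : ∀ K, IntegrableOn f (m.simplex K)) (i : Fin m.M) :
    ∫ x in m.patch i, f x = ∑ K ∈ m.star i, ∫ x in m.simplex K, f x := by
  rw [patch, m.restrict_biUnion_simplex, integral_finsetSum_measure fun K _ => hf K]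

theorem volume_real_eq_sum (hΩ : volume (frontier Ω) = 0) :
    volume.real Ω = ∑ K, volume.real (m.simplex K) := by
  have h := m.integral_eq_sum hΩ (f := fun _ => 1)
    fun K => integrableOn_const (m.volume_simplex_ne_top K)
  simpa using h

theorem volume_real_patch (i : Fin m.M) :
    volume.real (m.patch i) = ∑ K ∈ m.star i, volume.real (m.simplex K) := by
  have h := m.integral_patch (f := fun _ => 1)
    (fun K => integrableOn_const (m.volume_simplex_ne_top K)) i
  simpa using h

theorem star_nonempty (i : Fin m.M) : (m.star i).Nonempty := by
  obtain ⟨K, a, h⟩ := m.node_used i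
  exact ⟨K, m.mem_star.2 ⟨a, h⟩⟩

theorem volume_real_patch_pos (i : Fin m.M) : 0 < volume.real (m.patch i) := by
  rw [volume_real_patch]
  exact Finset.sum_pos (fun K _ => m.volume_simplex_pos K) (m.star_nonempty i)

theorem mass_eq (i : Fin m.M) : m.mass i = 1 / ((d : ℝ) + 1) * volume.real (m.patch i) := by
  rw [mass, volume_real_patch]

theorem mass_pos (i : Fin m.M) : 0 < m.mass i := by
  rw [mass_eq]
  have := m.volume_real_patch_pos i
  positivity

/-- Double counting of the incidences between nodes and elements; injectivity of `vert K` makes each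
incidence occur once. -/
theorem sum_star (f : Fin m.L → Fin m.M → ℝ) :
    ∑ i, ∑ K ∈ m.star i, f K i = ∑ K, ∑ a, f K (m.vert K a) := by
  classical
  have h1 : ∀ i, ∑ K ∈ m.star i, f K i = ∑ K, ∑ a, if m.vert K a = i then f K i else 0 := by
    intro i
    rw [star, Finset.sum_filter]
    refine Finset.sum_congr rfl fun K _ => ?_
    split_ifs with h
    · obtain ⟨a, rfl⟩ := h
      simp [(m.vert_injective K).eq_iff]
    · symm
      exact Finset.sum_eq_zero fun a _ => if_neg fun ha => h ⟨a, ha⟩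
  simp_rw [h1]
  rw [Finset.sum_comm]
  refine Finset.sum_congr rfl fun K _ => ?_
  rw [Finset.sum_comm]
  simp

theorem sum_star_inter (f : Fin m.L → Fin m.M → Fin m.M → ℝ) :
    ∑ i, ∑ j, ∑ K ∈ m.star i ∩ m.star j, f K i j =
      ∑ K, ∑ a, ∑ b, f K (m.vert K a) (m.vert K b) := by
  classical
  have h1 : ∀ i, ∑ j, ∑ K ∈ m.star i ∩ m.star j, f K i j =
      ∑ K ∈ m.star i, ∑ b, f K i (m.vert K b) := by
    intro i
    have h2 : ∀ j, ∑ K ∈ m.star i ∩ m.star j, f K i j =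
        ∑ K ∈ m.star j, if K ∈ m.star i then f K i j else 0 := fun j => by
      rw [← Finset.sum_filter, Finset.inter_comm, Finset.filter_mem_eq_inter]
    simp_rw [h2]
    rw [m.sum_star fun K j => if K ∈ m.star i then f K i j else 0,
      ← Finset.sum_filter_add_sum_filter_not _ (fun K => K ∈ m.star i)]
    rw [Finset.sum_eq_zero (s := Finset.univ.filter fun K => ¬ K ∈ m.star i), add_zero]
    · refine Finset.sum_congr (by ext; simp) fun K hK => ?_
      simp [hK]
    · intro K hK
      simp [(Finset.mem_filter.1 hK).2]
  simp_rw [h1]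
  exact m.sum_star fun K i => ∑ b, f K i (m.vert K b)

theorem sum_mass_mul (U : Fin m.M → ℝ) :
    ∑ i, m.mass i * U i =
      ∑ K, 1 / ((d : ℝ) + 1) * (volume.real (m.simplex K) * ∑ a, U (m.vert K a)) := by
  have h := m.sum_star fun K i => 1 / ((d : ℝ) + 1) * (volume.real (m.simplex K) * U i)
  simp_rw [mass, mul_assoc, Finset.sum_mul, Finset.mul_sum] at h ⊢
  exact h

theorem sum_mass (hΩ : volume (frontier Ω) = 0) : ∑ i, m.mass i = volume.real Ω := by
  have h := m.sum_mass_mul fun _ => 1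
  have hd : (d : ℝ) + 1 ≠ 0 := by positivity
  simp only [mul_one, Finset.sum_const, Finset.card_univ, Fintype.card_fin, nsmul_eq_mul,
    Nat.cast_add, Nat.cast_one] at h
  rw [h, m.volume_real_eq_sum hΩ]
  refine Finset.sum_congr rfl fun K _ => ?_
  field_simp

/-! ### Finite element functions -/

/-- `localFun` as an affine map. -/
def localAff (U : Fin m.M → ℝ) (K : Fin m.L) : Pt d →ᵃ[ℝ] ℝ :=
  ∑ a, U (m.vert K a) • (m.basis K).coord a

theorem localAff_apply (U : Fin m.M → ℝ) (K : Fin m.L) (x : Pt d) :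
    m.localAff U K x = m.localFun U K x := by
  rw [localAff, localFun]
  induction (Finset.univ : Finset (Fin (d + 1))) using Finset.cons_induction with
  | empty => simp
  | cons a s ha ih => rw [Finset.sum_cons, Finset.sum_cons, ← ih]; simp

theorem continuous_localFun (U : Fin m.M → ℝ) (K : Fin m.L) : Continuous (m.localFun U K) := by
  have := (m.localAff U K).continuous_of_finiteDimensional
  exact this.congr fun x => m.localAff_apply U K x

theorem localFun_node (U : Fin m.M → ℝ) (K : Fin m.L) (a : Fin (d + 1)) :
    m.localFun U K (m.node (m.vert K a)) = U (m.vert K a) := by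
  simp [localFun, ← basis_apply, AffineBasis.coord_apply]

/-- The two affine functions agree at the common vertices, hence on their convex hull, which by
conformity is the whole intersection. -/
theorem localFun_eq_localFun (U : Fin m.M → ℝ) {K K' : Fin m.L} {x : Pt d}
    (hx : x ∈ m.simplex K) (hx' : x ∈ m.simplex K') : m.localFun U K x = m.localFun U K' x := by
  have hconv : Convex ℝ {x | m.localFun U K x = m.localFun U K' x} := by
    have h := (convex_singleton (𝕜 := ℝ) (0 : ℝ)).affine_preimage
      (m.localAff U K - m.localAff U K')
    have e : {x | m.localFun U K x = m.localFun U K' x} =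
        ⇑(m.localAff U K - m.localAff U K') ⁻¹' {0} := by
      ext x
      rw [mem_preimage, mem_singleton_iff, AffineMap.coe_sub, Pi.sub_apply, localAff_apply,
        localAff_apply, sub_eq_zero, mem_ofPred_eq]
    rw [e]
    exact h
  have hmem : x ∈ convexHull ℝ (m.node '' (range (m.vert K) ∩ range (m.vert K'))) :=
    m.conforming K K' ▸ ⟨hx, hx'⟩
  refine convexHull_min ?_ hconv hmem
  rintro _ ⟨_, ⟨⟨a, rfl⟩, ⟨b, hb⟩⟩, rfl⟩
  have h2 := m.localFun_node U K' b
  rw [hb] at h2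
  exact (m.localFun_node U K a).trans h2.symm

theorem feFun_eq_localFun (U : Fin m.M → ℝ) {K : Fin m.L} {x : Pt d} (hx : x ∈ m.simplex K) :
    m.feFun U x = m.localFun U K x := by
  have h : ∃ K, x ∈ m.simplex K := ⟨K, hx⟩
  rw [feFun, dif_pos h]
  exact m.localFun_eq_localFun U h.choose_spec hx

theorem continuousOn_feFun (U : Fin m.M → ℝ) : ContinuousOn (m.feFun U) (closure Ω) := by
  rw [← m.iUnion_simplex]
  refine (locallyFinite_of_finite _).continuousOn_iUnion
    (fun K => (m.isCompact_simplex K).isClosed) fun K => ?_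
  exact (m.continuous_localFun U K).continuousOn.congr fun x hx => m.feFun_eq_localFun U hx

/-- Gradients of the barycentric coordinates. -/
def coordGrad (K : Fin m.L) (a : Fin (d + 1)) : Pt d := gradient ((m.basis K).coord a) 0

theorem coord_sub_coord (K : Fin m.L) (a : Fin (d + 1)) (x y : Pt d) :
    (m.basis K).coord a x - (m.basis K).coord a y = ⟪m.coordGrad K a, x - y⟫_ℝ := by
  obtain ⟨g, h1, h2⟩ := affineMap_hasGradientAt ((m.basis K).coord a)
  rw [h2, coordGrad, h1]

theorem gradient_hatOn (K : Fin m.L) (a : Fin (d + 1)) (x : Pt d) :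
    gradient (m.hatOn (m.vert K a) K) x = m.coordGrad K a := by
  have e : m.hatOn (m.vert K a) K = (m.basis K).coord a := by
    ext y
    simp [hatOn, localFun, Pi.single_apply, (m.vert_injective K).eq_iff]
  obtain ⟨g, h1, -⟩ := affineMap_hasGradientAt ((m.basis K).coord a)
  rw [e, coordGrad, h1, h1]

/-- The gradient on the element `K` of the finite element function with nodal values `U`. -/
def slope (U : Fin m.M → ℝ) (K : Fin m.L) : Pt d := ∑ a, U (m.vert K a) • m.coordGrad K a

theorem localFun_sub_localFun (U : Fin m.M → ℝ) (K : Fin m.L) (x y : Pt d) :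
    m.localFun U K x - m.localFun U K y = ⟪m.slope U K, x - y⟫_ℝ := by
  rw [localFun, localFun, ← Finset.sum_sub_distrib, slope, sum_inner]
  refine Finset.sum_congr rfl fun a _ => ?_
  rw [real_inner_smul_left, ← coord_sub_coord]
  ring

theorem abs_localFun_sub_le (U : Fin m.M → ℝ) (K : Fin m.L) (x y : Pt d) :
    |m.localFun U K x - m.localFun U K y| ≤ ‖m.slope U K‖ * ‖x - y‖ := by
  rw [localFun_sub_localFun]
  exact abs_real_inner_le_norm _ _

theorem sum_coordGrad (K : Fin m.L) : ∑ a, m.coordGrad K a = 0 := by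
  refine ext_inner_right ℝ fun v => ?_
  have h := fun a => m.coord_sub_coord K a v 0
  rw [sum_inner, inner_zero_left]
  simp only [sub_zero] at h
  simp_rw [← h, Finset.sum_sub_distrib, AffineBasis.sum_coord_apply_eq_one, sub_self]

/-- The Gram matrix of the gradients of the barycentric coordinates has zero row and column sums,
since these coordinates sum to 1. Its quadratic form is therefore a combination of squared
differences with coefficients -⟪β_a, β_b⟫/2, and -x ≤ |x| concludes. -/
theorem norm_slope_sq_le (U : Fin m.M → ℝ) (K : Fin m.L) :
    ‖m.slope U K‖ ^ 2 ≤ 1 / 2 * ∑ a, ∑ b,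
      |⟪m.coordGrad K a, m.coordGrad K b⟫_ℝ| * (U (m.vert K a) - U (m.vert K b)) ^ 2 := by
  set β := m.coordGrad K with hβ
  set V := fun a => U (m.vert K a) with hV
  have h0 : ∀ a, ∑ b, ⟪β a, β b⟫_ℝ = 0 := fun a => by
    rw [← inner_sum, hβ, sum_coordGrad, inner_zero_right]
  have h0' : ∀ b, ∑ a, ⟪β a, β b⟫_ℝ = 0 := fun b => by
    rw [← sum_inner, hβ, sum_coordGrad, inner_zero_left]
  have h1 : ‖m.slope U K‖ ^ 2 = ∑ a, ∑ b, V a * V b * ⟪β a, β b⟫_ℝ := by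
    rw [← real_inner_self_eq_norm_sq, slope, sum_inner]
    refine Finset.sum_congr rfl fun a _ => ?_
    rw [inner_sum]
    refine Finset.sum_congr rfl fun b _ => ?_
    rw [real_inner_smul_left, real_inner_smul_right]
    ring
  have hA : ∑ a, ∑ b, V a ^ 2 * ⟪β a, β b⟫_ℝ = 0 :=
    Finset.sum_eq_zero fun a _ => by rw [← Finset.mul_sum, h0, mul_zero]
  have hB : ∑ a, ∑ b, V b ^ 2 * ⟪β a, β b⟫_ℝ = 0 := by
    rw [Finset.sum_comm]
    exact Finset.sum_eq_zero fun a _ => by rw [← Finset.mul_sum, h0', mul_zero]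
  have h2 : ‖m.slope U K‖ ^ 2 = 1 / 2 * ∑ a, ∑ b, -⟪β a, β b⟫_ℝ * (V a - V b) ^ 2 := by
    have h3 : ∑ a, ∑ b, -⟪β a, β b⟫_ℝ * (V a - V b) ^ 2 =
        2 * (∑ a, ∑ b, V a * V b * ⟪β a, β b⟫_ℝ) - ∑ a, ∑ b, V a ^ 2 * ⟪β a, β b⟫_ℝ -
          ∑ a, ∑ b, V b ^ 2 * ⟪β a, β b⟫_ℝ := by
      simp_rw [Finset.mul_sum, ← Finset.sum_sub_distrib]
      exact Finset.sum_congr rfl fun a _ => Finset.sum_congr rfl fun b _ => by ring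
    rw [h3, hA, hB, h1]
    ring
  rw [h2]
  gcongr with a _ b _
  exact neg_le_abs _

/-- The gradients are constant on each element, so the integrals are products; the evaluation point
0 is arbitrary. -/
theorem c_eq (i j : Fin m.M) : m.c i j = ∑ K ∈ m.star i ∩ m.star j, volume.real (m.simplex K) *
    |⟪gradient (m.hatOn i K) 0, gradient (m.hatOn j K) 0⟫_ℝ| := by
  refine Finset.sum_congr rfl fun K hK => ?_
  obtain ⟨a, rfl⟩ := m.mem_star.1 (Finset.mem_inter.1 hK).1
  obtain ⟨b, rfl⟩ := m.mem_star.1 (Finset.mem_inter.1 hK).2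
  simp_rw [gradient_hatOn]
  simp

theorem c_nonneg (i j : Fin m.M) : 0 ≤ m.c i j :=
  Finset.sum_nonneg fun _ _ => integral_nonneg fun _ => abs_nonneg _

theorem c_comm (i j : Fin m.M) : m.c i j = m.c j i := by
  rw [c, c, Finset.inter_comm]
  simp_rw [real_inner_comm]

theorem sum_c_mul (F : Fin m.M → Fin m.M → ℝ) :
    ∑ i, ∑ j, m.c i j * F i j = ∑ K, volume.real (m.simplex K) * ∑ a, ∑ b,
      |⟪m.coordGrad K a, m.coordGrad K b⟫_ℝ| * F (m.vert K a) (m.vert K b) := by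
  have h := m.sum_star_inter fun K i j => volume.real (m.simplex K) *
    |⟪gradient (m.hatOn i K) 0, gradient (m.hatOn j K) 0⟫_ℝ| * F i j
  simp_rw [c_eq, Finset.sum_mul]
  rw [h]
  simp_rw [gradient_hatOn, Finset.mul_sum, mul_assoc]

/-- The Dirichlet energy of a finite element function is bounded by the sum of the squares of the
differences of its nodal values, weighted by the coefficients `c_ij`. -/
theorem dirichlet_le (U : Fin m.M → ℝ) :
    ∑ K, volume.real (m.simplex K) * ‖m.slope U K‖ ^ 2 ≤
      1 / 2 * ∑ i, ∑ j, m.c i j * (U i - U j) ^ 2 := by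
  rw [m.sum_c_mul fun i j => (U i - U j) ^ 2, Finset.mul_sum]
  refine Finset.sum_le_sum fun K _ => ?_
  rw [mul_left_comm]
  gcongr
  exact m.norm_slope_sq_le U K

/-! ### Exactness of the vertex quadrature -/

theorem integrableOn_localFun (U : Fin m.M → ℝ) (K K' : Fin m.L) :
    IntegrableOn (m.localFun U K) (m.simplex K') :=
  (m.continuous_localFun U K).continuousOn.integrableOn_compact (m.isCompact_simplex K')

/-- The affine map T exchanging the vertices a and b maps the simplex onto itself and exchanges the
two coordinates. -/
theorem integral_coord_eq (K : Fin m.L) (a b : Fin (d + 1)) :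
    ∫ x in m.simplex K, (m.basis K).coord a x = ∫ x in m.simplex K, (m.basis K).coord b x := by
  classical
  set e := Equiv.swap a b with he
  set T : Pt d →ᵃ[ℝ] Pt d := ∑ i, ((LinearMap.toSpanSingleton ℝ (Pt d)
    (m.basis K (e i))).toAffineMap).comp ((m.basis K).coord i) with hT
  have hTx : ∀ x, T x = ∑ i, (m.basis K).coord i x • m.basis K (e i) := by
    intro x
    rw [hT]
    induction (Finset.univ : Finset (Fin (d + 1))) using Finset.cons_induction with
    | empty => simp
    | cons a s ha ih => rw [Finset.sum_cons, Finset.sum_cons, ← ih]; simp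
  have hTv : ∀ i, T (m.basis K i) = m.basis K (e i) := by
    intro i
    rw [hTx]
    simp [AffineBasis.coord_apply]
  have hcoord : ∀ i x, (m.basis K).coord i (T x) = (m.basis K).coord (e i) x := by
    intro i x
    have : ((m.basis K).coord i).comp T = (m.basis K).coord (e i) := by
      refine AffineMap.ext_on (s := range (m.basis K)) (m.basis K).tot ?_
      rintro _ ⟨j, rfl⟩
      simp only [AffineMap.comp_apply, hTv, AffineBasis.coord_apply]
      congr 1
      rw [he, eq_iff_iff]
      constructor
      · rintro rfl; simp
      · rintro rfl; simp
    exact DFunLike.congr_fun this x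
  have himg : T '' m.simplex K = m.simplex K := by
    rw [simplex_eq, AffineMap.image_convexHull, ← range_comp]
    congr 1
    have : (T ∘ m.basis K) = m.basis K ∘ e := funext hTv
    rw [this, range_comp, e.range_eq_univ, image_univ]
  have hinj : Function.Injective T := by
    intro x y hxy
    refine (m.basis K).ext_elem fun i => ?_
    have h1 := hcoord (e.symm i) x
    have h2 := hcoord (e.symm i) y
    rw [hxy, h2] at h1
    simpa using h1.symm
  set l : Pt d →L[ℝ] Pt d := LinearMap.toContinuousLinearMap T.linear with hl
  have hder : ∀ x ∈ m.simplex K, HasFDerivWithinAt T l (m.simplex K) x := by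
    intro x _
    have h1 : HasFDerivAt (fun x => l x + T 0) l x := l.hasFDerivAt.add_const _
    have h2 : ∀ x, T x = l x + T 0 := fun x => by
      have := congrFun T.decomp x
      simpa [hl] using this
    exact (h1.congr_of_eventuallyEq (Filter.Eventually.of_forall h2)).hasFDerivWithinAt
  have hcv := fun g : Pt d → ℝ => integral_image_eq_integral_abs_det_fderiv_smul volume
    (m.measurableSet_simplex K) hder hinj.injOn g
  simp only [himg, smul_eq_mul, integral_const_mul] at hcv
  -- The change of variables applied to the constant 1 shows that T preserves volume, because it
  -- preserves a set of positive finite measure.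
  have hdet : |l.det| = 1 := by
    have h1 := hcv fun _ => 1
    simp only [integral_const, smul_eq_mul, mul_one, measureReal_restrict_apply_univ] at h1
    have h2 := m.volume_simplex_pos K
    exact mul_right_cancel₀ h2.ne' (h1.symm.trans (one_mul _).symm)
  rw [hcv fun x => (m.basis K).coord a x, hdet, one_mul]
  simp_rw [hcoord, he, Equiv.swap_apply_left]

theorem continuous_coord (K : Fin m.L) (a : Fin (d + 1)) : Continuous ((m.basis K).coord a) :=
  ((m.basis K).coord a).continuous_of_finiteDimensional

theorem integrableOn_coord (K : Fin m.L) (a : Fin (d + 1)) :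
    IntegrableOn ((m.basis K).coord a) (m.simplex K) :=
  (m.continuous_coord K a).continuousOn.integrableOn_compact (m.isCompact_simplex K)

theorem integral_coord (K : Fin m.L) (a : Fin (d + 1)) :
    ∫ x in m.simplex K, (m.basis K).coord a x = 1 / ((d : ℝ) + 1) * volume.real (m.simplex K) := by
  have h1 : ∑ b, ∫ x in m.simplex K, (m.basis K).coord b x = volume.real (m.simplex K) := by
    rw [← integral_finsetSum _ fun b _ => m.integrableOn_coord K b]
    simp_rw [AffineBasis.sum_coord_apply_eq_one]
    simp
  rw [Finset.sum_congr rfl fun b _ => m.integral_coord_eq K b a] at h1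
  simp only [Finset.sum_const, Finset.card_univ, Fintype.card_fin, nsmul_eq_mul, Nat.cast_add,
    Nat.cast_one] at h1
  rw [← h1]
  field_simp

theorem integral_localFun (U : Fin m.M → ℝ) (K : Fin m.L) :
    ∫ x in m.simplex K, m.localFun U K x =
      1 / ((d : ℝ) + 1) * (volume.real (m.simplex K) * ∑ a, U (m.vert K a)) := by
  simp_rw [localFun]
  rw [integral_finsetSum _ fun a _ => (m.integrableOn_coord K a).const_mul _]
  simp_rw [integral_const_mul, integral_coord, Finset.mul_sum]
  exact Finset.sum_congr rfl fun a _ => by ring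

theorem integrableOn_feFun (U : Fin m.M → ℝ) (K : Fin m.L) :
    IntegrableOn (m.feFun U) (m.simplex K) :=
  (m.integrableOn_localFun U K K).congr_fun (fun _ hx => (m.feFun_eq_localFun U hx).symm)
    (m.measurableSet_simplex K)

theorem integral_feFun (hΩ : volume (frontier Ω) = 0) (U : Fin m.M → ℝ) :
    ∫ x in Ω, m.feFun U x = ∑ i, m.mass i * U i := by
  rw [m.integral_eq_sum hΩ (m.integrableOn_feFun U), m.sum_mass_mul]
  refine Finset.sum_congr rfl fun K _ => ?_
  rw [← integral_localFun]
  exact setIntegral_congr_fun (m.measurableSet_simplex K) fun x hx => m.feFun_eq_localFun U hx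

theorem mass_mul_rh {g : Pt d → ℝ} (hg : ∀ K, IntegrableOn g (m.simplex K)) (i : Fin m.M) :
    m.mass i * m.rh g i = 1 / ((d : ℝ) + 1) * ∑ K ∈ m.star i, ∫ x in m.simplex K, g x := by
  have h := (m.volume_real_patch_pos i).ne'
  rw [rh, setAverage_eq, mass_eq, ← m.integral_patch hg, smul_eq_mul]
  field_simp

/-- The factor |Δ_i| in the mass cancels the one in the mean, and each element is then counted d + 1
times with weight 1/(d+1). -/
theorem sum_mass_rh (hΩ : volume (frontier Ω) = 0) {g : Pt d → ℝ} (hg : IntegrableOn g Ω) :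
    ∑ i, m.mass i * m.rh g i = ∫ x in Ω, g x := by
  have hK := m.integrableOn_simplex hΩ hg
  simp_rw [m.mass_mul_rh hK, m.integral_eq_sum hΩ hK, Finset.mul_sum]
  rw [m.sum_star fun K i => 1 / ((d : ℝ) + 1) * ∫ x in m.simplex K, g x]
  refine Finset.sum_congr rfl fun K _ => ?_
  simp only [Finset.sum_const, Finset.card_univ, Fintype.card_fin, nsmul_eq_mul, Nat.cast_add,
    Nat.cast_one]
  field_simp

/-- Vertex quadrature is exact for piecewise affine functions, so r_h(g) and g have the same
integral and the correction vanishes. -/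
theorem rhCorr_eq_rh (hΩ : volume (frontier Ω) = 0) {g : Pt d → ℝ} (hg : IntegrableOn g Ω)
    (i : Fin m.M) : m.rhCorr g i = m.rh g i := by
  have hfe : IntegrableOn (m.feFun (m.rh g)) Ω := by
    rw [IntegrableOn, m.restrict_eq_sum hΩ, integrable_finsetSum_measure]
    exact fun K _ => m.integrableOn_feFun _ K
  rw [rhCorr, integral_sub hfe hg, m.integral_feFun hΩ, m.sum_mass_rh hΩ hg]
  simp

end Mesh

/-! ### A discrete Poincaré inequality -/

theorem sq_lintegral_Icc_le {g : ℝ → ℝ≥0∞} (hg : AEMeasurable g (volume.restrict (Icc 0 1))) :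
    (∫⁻ t in Icc (0 : ℝ) 1, g t) ^ 2 ≤ ∫⁻ t in Icc (0 : ℝ) 1, g t ^ 2 := by
  have h := ENNReal.lintegral_mul_le_Lp_mul_Lq (volume.restrict (Icc (0 : ℝ) 1))
    Real.HolderConjugate.two_two hg (aemeasurable_const (b := (1 : ℝ≥0∞)))
  simp only [Pi.mul_apply, mul_one, lintegral_const, Measure.restrict_apply_univ, Real.volume_Icc,
    sub_zero, ENNReal.ofReal_one, ENNReal.rpow_two, one_pow, ENNReal.one_rpow] at h
  calc (∫⁻ t in Icc (0 : ℝ) 1, g t) ^ 2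
      ≤ ((∫⁻ t in Icc (0 : ℝ) 1, g t ^ 2) ^ (1 / (2 : ℝ))) ^ 2 := by gcongr
    _ = ∫⁻ t in Icc (0 : ℝ) 1, g t ^ 2 := by
      rw [← ENNReal.rpow_two, ← ENNReal.rpow_mul]
      norm_num

/-- The increment of a continuous function which is Lipschitz on the sets of a finite cover. -/
theorem enorm_sub_le_of_cover {ι : Type*} [Fintype ι] {f : ℝ → ℝ} (hf : ContinuousOn f (Icc 0 1))
    (A : ι → Set ℝ) (L : ι → ℝ≥0) (hcov : Icc 0 1 ⊆ ⋃ i, A i)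
    (hL : ∀ i, LipschitzOnWith (L i) f (A i ∩ Icc 0 1)) :
    ‖f 1 - f 0‖ₑ ≤ ∑ i, L i * volume (A i ∩ Icc 0 1) := by
  have h1 : ‖f 1 - f 0‖ₑ = volume (uIcc (f 0) (f 1)) := by
    rw [Real.volume_interval, ← Real.norm_eq_abs, ofReal_norm]
  -- By the intermediate value theorem the images of the pieces cover the interval between the end
  -- values; a Lipschitz map multiplies length by at most its constant.
  have h2 : uIcc (f 0) (f 1) ⊆ ⋃ i, f '' (A i ∩ Icc 0 1) := by
    rw [← image_iUnion, ← iUnion_inter, inter_eq_right.2 hcov]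
    have := intermediate_value_uIcc (f := f) (a := 0) (b := 1)
      (by rwa [uIcc_of_le zero_le_one])
    rwa [uIcc_of_le (zero_le_one (α := ℝ))] at this
  rw [h1]
  refine (measure_mono h2).trans ((measure_iUnion_fintype_le _ _).trans ?_)
  refine Finset.sum_le_sum fun i _ => ?_
  have := (hL i).hausdorffMeasure_image_le zero_le_one
  rwa [hausdorffMeasure_real, ENNReal.rpow_one] at this

namespace Mesh

variable {d : ℕ} {Ω : Set (Pt d)} (m : Mesh d Ω)

/-- The cross terms live on intersections of distinct elements, which are null. -/
theorem lintegral_sum_indicator_sq (L : Fin m.L → ℝ≥0) :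
    ∫⁻ z, (∑ K, (m.simplex K).indicator (fun _ => (L K : ℝ≥0∞)) z) ^ 2 =
      ∑ K, (L K : ℝ≥0∞) ^ 2 * volume (m.simplex K) := by
  have hm : ∀ K, MeasurableSet (m.simplex K) := m.measurableSet_simplex
  have h : ∀ z, (∑ K, (m.simplex K).indicator (fun _ => (L K : ℝ≥0∞)) z) ^ 2 =
      ∑ K, ∑ K', (m.simplex K ∩ m.simplex K').indicator
        (fun _ => (L K : ℝ≥0∞) * L K') z := by
    intro z
    rw [sq, Finset.sum_mul_sum]
    refine Finset.sum_congr rfl fun K _ => Finset.sum_congr rfl fun K' _ => ?_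
    by_cases h1 : z ∈ m.simplex K <;> by_cases h2 : z ∈ m.simplex K' <;> simp [h1, h2]
  simp_rw [h]
  rw [lintegral_finsetSum]
  swap
  · exact fun K _ => Finset.measurable_sum _ fun K' _ =>
      measurable_const.indicator ((hm K).inter (hm K'))
  refine Finset.sum_congr rfl fun K _ => ?_
  rw [lintegral_finsetSum]
  swap
  · exact fun K' _ => measurable_const.indicator ((hm K).inter (hm K'))
  rw [Finset.sum_eq_single K]
  · rw [inter_self, lintegral_indicator_const (hm K), sq]
  · intro K' _ hne
    rw [lintegral_indicator_const ((hm K).inter (hm K')), m.aedisjoint_simplex hne.symm, mul_zero]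
  · simp

/-- Along a segment of direction v the function has Lipschitz constant ‖slope‖ ‖v‖ on each element,
so its increment is at most the integral of the piecewise constant G along the segment.
Cauchy–Schwarz, Tonelli and translation invariance of Lebesgue measure then give the bound. Elements
are closed and may overlap, hence the sum in G. -/
theorem shiftBound_feFun (U : Fin m.M → ℝ) :
    ShiftBound Ω (Ω.indicator (m.feFun U))
      (∑ K, volume (m.simplex K) * ‖m.slope U K‖ₑ ^ 2) := by
  intro V v hV hΩ
  set L : Fin m.L → ℝ≥0 := fun K => ‖m.slope U K‖₊ * ‖v‖₊ with hL
  set G : Pt d → ℝ≥0∞ := fun z => ∑ K, (m.simplex K).indicator (fun _ => (L K : ℝ≥0∞)) z with hG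
  have hGm : Measurable G := Finset.measurable_sum _ fun K _ =>
    measurable_const.indicator (m.measurableSet_simplex K)
  have hpt : ∀ y ∈ V, ‖Ω.indicator (m.feFun U) (y + v) - Ω.indicator (m.feFun U) y‖ₑ ^ 2 ≤
      ∫⁻ t in Icc (0 : ℝ) 1, G (y + t • v) ^ 2 := by
    intro y hy
    have hline : Continuous fun t : ℝ => y + t • v := by fun_prop
    refine le_trans ?_ (sq_lintegral_Icc_le (hGm.comp hline.measurable).aemeasurable)
    gcongr
    have h0 : y ∈ Ω := by simpa using hΩ y hy 0 (by simp)
    have h1 : y + v ∈ Ω := by simpa using hΩ y hy 1 (by simp)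
    rw [indicator_of_mem h0, indicator_of_mem h1]
    have hcov := enorm_sub_le_of_cover (f := fun t => m.feFun U (y + t • v))
      ((m.continuousOn_feFun U).comp hline.continuousOn
        fun t ht => subset_closure (hΩ y hy t ht))
      (fun K => (fun t : ℝ => y + t • v) ⁻¹' m.simplex K) L ?_ ?_
    · simp only [one_smul, zero_smul, add_zero] at hcov
      refine hcov.trans (le_of_eq ?_)
      rw [hG, lintegral_finsetSum]
      · refine Finset.sum_congr rfl fun K _ => ?_
        have hm : MeasurableSet ((fun t : ℝ => y + t • v) ⁻¹' m.simplex K) :=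
          hline.measurable (m.measurableSet_simplex K)
        rw [← Measure.restrict_apply hm, ← lintegral_indicator_const hm]
        rfl
      · exact fun K _ => (measurable_const.indicator (m.measurableSet_simplex K)).comp
          hline.measurable
    · intro t ht
      have := subset_closure (hΩ y hy t ht)
      rw [← m.iUnion_simplex, mem_iUnion] at this
      simpa using this
    · intro K
      refine LipschitzOnWith.of_dist_le_mul fun s hs t ht => ?_
      rw [m.feFun_eq_localFun U hs.1, m.feFun_eq_localFun U ht.1, Real.dist_eq]
      refine (m.abs_localFun_sub_le U K _ _).trans (le_of_eq ?_)
      rw [add_sub_add_left_eq_sub, ← sub_smul, norm_smul, Real.dist_eq, hL]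
      push_cast
      rw [Real.norm_eq_abs]
      ring
  calc ∫⁻ y in V, ‖Ω.indicator (m.feFun U) (y + v) - Ω.indicator (m.feFun U) y‖ₑ ^ 2
      ≤ ∫⁻ y in V, ∫⁻ t in Icc (0 : ℝ) 1, G (y + t • v) ^ 2 := setLIntegral_mono' hV hpt
    _ = ∫⁻ t in Icc (0 : ℝ) 1, ∫⁻ y in V, G (y + t • v) ^ 2 := by
        refine lintegral_lintegral_swap (Measurable.aemeasurable ?_)
        have hc : Continuous fun p : Pt d × ℝ => p.1 + p.2 • v := by fun_prop
        exact (hGm.comp hc.measurable).pow_const 2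
    _ ≤ ∫⁻ t in Icc (0 : ℝ) 1, ∫⁻ z, G z ^ 2 := by
        refine lintegral_mono fun t => ?_
        refine (setLIntegral_le_lintegral _ _).trans (le_of_eq ?_)
        exact lintegral_add_right_eq_self (fun z => G z ^ 2) (t • v)
    _ = ∫⁻ z, G z ^ 2 := by simp
    _ = ‖v‖ₑ ^ 2 * ∑ K, volume (m.simplex K) * ‖m.slope U K‖ₑ ^ 2 := by
        rw [hG, m.lintegral_sum_indicator_sq, Finset.mul_sum]
        refine Finset.sum_congr rfl fun K _ => ?_
        rw [hL]
        push_cast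
        rw [← enorm_eq_nnnorm, ← enorm_eq_nnnorm]
        ring

theorem measurable_indicator_feFun (hO : IsOpen Ω) (U : Fin m.M → ℝ) :
    Measurable (Ω.indicator (m.feFun U)) := by
  classical
  rw [← piecewise_eq_indicator]
  exact ((m.continuousOn_feFun U).mono subset_closure).measurable_piecewise continuousOn_const
    hO.measurableSet

/-- Comparison of the lumped and the exact `L²` norms. -/
theorem sum_mass_sq_le (hb : Bornology.IsBounded Ω) (U : Fin m.M → ℝ) (c : ℝ) :
    ∑ i, m.mass i * (U i - c) ^ 2 ≤
      2 * (∑ K, ∫ x in m.simplex K, (m.localFun U K x - c) ^ 2) +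
        2 * Metric.diam (closure Ω) ^ 2 *
          ∑ K, volume.real (m.simplex K) * ‖m.slope U K‖ ^ 2 := by
  rw [m.sum_mass_mul fun i => (U i - c) ^ 2, Finset.mul_sum, Finset.mul_sum,
    ← Finset.sum_add_distrib]
  refine Finset.sum_le_sum fun K _ => ?_
  set R := Metric.diam (closure Ω) with hR
  set s := ‖m.slope U K‖ with hs
  set J := ∫ x in m.simplex K, (m.localFun U K x - c) ^ 2 with hJ
  have hint : IntegrableOn (fun x => (m.localFun U K x - c) ^ 2) (m.simplex K) :=
    (((m.continuous_localFun U K).sub continuous_const).pow 2).continuousOn.integrableOn_compact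
      (m.isCompact_simplex K)
  have : IsFiniteMeasure (volume.restrict (m.simplex K)) :=
    ⟨by simpa using (m.isCompact_simplex K).measure_lt_top⟩
  -- The value at a vertex differs from the value at any x of the element by at most slope times
  -- diameter; square this and integrate over x.
  have ha : ∀ a, volume.real (m.simplex K) * (U (m.vert K a) - c) ^ 2 ≤
      2 * J + 2 * R ^ 2 * (volume.real (m.simplex K) * s ^ 2) := by
    intro a
    have h1 : volume.real (m.simplex K) * (U (m.vert K a) - c) ^ 2 =
        ∫ x in m.simplex K, (U (m.vert K a) - c) ^ 2 := by simp
    have h2 : 2 * J + 2 * R ^ 2 * (volume.real (m.simplex K) * s ^ 2) =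
        ∫ x in m.simplex K, (2 * (m.localFun U K x - c) ^ 2 + 2 * (R ^ 2 * s ^ 2)) := by
      rw [integral_add (hint.const_mul 2) (integrable_const _), integral_const_mul]
      simp only [integral_const, smul_eq_mul, measureReal_restrict_apply_univ]
      ring
    rw [h1, h2]
    refine setIntegral_mono_on (integrable_const _)
      ((hint.const_mul 2).add (integrable_const _)) (m.measurableSet_simplex K) fun x hx => ?_
    have h3 := m.abs_localFun_sub_le U K (m.node (m.vert K a)) x
    rw [m.localFun_node] at h3
    have h4 : ‖m.node (m.vert K a) - x‖ ≤ R := by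
      rw [← dist_eq_norm]
      exact Metric.dist_le_diam_of_mem hb.closure (m.simplex_subset K (m.node_mem_simplex K a))
        (m.simplex_subset K hx)
    have h5 : |U (m.vert K a) - m.localFun U K x| ≤ s * R := h3.trans (by gcongr)
    have h6 : (U (m.vert K a) - m.localFun U K x) ^ 2 ≤ (s * R) ^ 2 := by
      rw [← sq_abs]
      gcongr
    nlinarith [sq_nonneg ((U (m.vert K a) - m.localFun U K x) - (m.localFun U K x - c))]
  have hsum := Finset.sum_le_sum fun a (_ : a ∈ Finset.univ) => ha a
  rw [← Finset.mul_sum, Finset.sum_const, Finset.card_univ, Fintype.card_fin, nsmul_eq_mul] at hsum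
  push_cast at hsum
  rw [one_div, inv_mul_le_iff₀ (by positivity)]
  exact hsum

end Mesh

/-- The Poincaré inequality for finite element functions, with lumped `L²` norm and with a constant
which does not depend on the mesh. -/
theorem exists_discrete_poincare {d : ℕ} {Ω : Set (Pt d)} (hO : IsOpen Ω) (hc : IsConnected Ω)
    (hb : Bornology.IsBounded Ω) (hl : HasLipschitzBoundary Ω) :
    ∃ C : ℝ, 0 ≤ C ∧ ∀ (m : Mesh d Ω) (U : Fin m.M → ℝ), ∃ c : ℝ,
      ∑ i, m.mass i * (U i - c) ^ 2 ≤ C * ∑ i, ∑ j, m.c i j * (U i - U j) ^ 2 := by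
  obtain ⟨C, hC, H⟩ := poincareOn_of_hasLipschitzBoundary hO hc hb hl
  have hΩ := volume_frontier_eq_zero hO hl
  -- The lumped norm is at most 2(C + diam²) times the Dirichlet energy, and the energy is at most
  -- half of the weighted sum of squares.
  refine ⟨C.toReal + Metric.diam (closure Ω) ^ 2, by positivity, fun m U => ?_⟩
  obtain ⟨c, hle⟩ := H _ (m.measurable_indicator_feFun hO U) _ (m.shiftBound_feFun U)
  refine ⟨c, ?_⟩
  set D := ∑ K, volume.real (m.simplex K) * ‖m.slope U K‖ ^ 2 with hD
  have hD0 : 0 ≤ D := Finset.sum_nonneg fun _ _ => by positivity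
  have hDe : ∑ K, volume (m.simplex K) * ‖m.slope U K‖ₑ ^ 2 = ENNReal.ofReal D := by
    rw [hD, ENNReal.ofReal_sum_of_nonneg fun _ _ => by positivity]
    refine Finset.sum_congr rfl fun K _ => ?_
    rw [ENNReal.ofReal_mul (by positivity), ENNReal.ofReal_pow (by positivity), ofReal_norm,
      Measure.real, ENNReal.ofReal_toReal (m.volume_simplex_ne_top K)]
  have hJ : ∫⁻ x in Ω, ‖Ω.indicator (m.feFun U) x - c‖ₑ ^ 2 =
      ENNReal.ofReal (∑ K, ∫ x in m.simplex K, (m.localFun U K x - c) ^ 2) := by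
    have h1 : ∫⁻ x in Ω, ‖Ω.indicator (m.feFun U) x - c‖ₑ ^ 2 =
        ∫⁻ x in Ω, ‖m.feFun U x - c‖ₑ ^ 2 :=
      setLIntegral_congr_fun hO.measurableSet fun x hx => by simp only [indicator_of_mem hx]
    rw [h1, m.lintegral_eq_sum hΩ, ENNReal.ofReal_sum_of_nonneg fun _ _ =>
      integral_nonneg fun _ => sq_nonneg _]
    refine Finset.sum_congr rfl fun K _ => ?_
    rw [ofReal_integral_eq_lintegral_ofReal _ (Filter.Eventually.of_forall fun _ => sq_nonneg _)]
    · refine setLIntegral_congr_fun (m.measurableSet_simplex K) fun x hx => ?_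
      simp only [m.feFun_eq_localFun U hx]
      rw [← sq_abs, ENNReal.ofReal_pow (abs_nonneg _), ← Real.norm_eq_abs, ofReal_norm]
    · exact (((m.continuous_localFun U K).sub
        continuous_const).pow 2).continuousOn.integrableOn_compact (m.isCompact_simplex K)
  rw [hJ, hDe, ← ENNReal.ofReal_toReal hC, ← ENNReal.ofReal_mul (by positivity),
    ENNReal.ofReal_le_ofReal_iff (by positivity)] at hle
  have h1 := m.sum_mass_sq_le hb U c
  have h2 := m.dirichlet_le U
  rw [← hD] at h1 h2
  have h3 : 0 ≤ C.toReal + Metric.diam (closure Ω) ^ 2 := by positivity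
  nlinarith [mul_le_mul_of_nonneg_left h2 h3]

/-! ### Estimates of the discrete data -/

/-- Cauchy–Schwarz, from the nonnegativity of the integral of (M g - I)². Dividing by the total mass
M requires it to be positive, hence the separate case of the zero measure. -/
theorem sq_integral_le {α : Type*} [MeasurableSpace α] {μ : Measure α} [IsFiniteMeasure μ]
    {g : α → ℝ} (hg : Integrable g μ) (hg2 : Integrable (fun x => g x ^ 2) μ) :
    (∫ x, g x ∂μ) ^ 2 ≤ μ.real univ * ∫ x, g x ^ 2 ∂μ := by
  set M := μ.real univ with hM
  set I := ∫ x, g x ∂μ with hI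
  rcases eq_or_lt_of_le (measureReal_nonneg (μ := μ) (s := univ)) with h0 | hpos
  · have : μ = 0 := by
      rw [← Measure.measure_univ_eq_zero, ← measureReal_eq_zero_iff]
      exact h0.symm
    simp [hI, this]
  · have h1 : ∫ x, (M ^ 2 * g x ^ 2 - 2 * M * I * g x + I ^ 2) ∂μ =
        M ^ 2 * (∫ x, g x ^ 2 ∂μ) - 2 * M * I * I + M * I ^ 2 := by
      rw [integral_add (f := fun x => M ^ 2 * g x ^ 2 - 2 * M * I * g x)
          ((hg2.const_mul _).sub (hg.const_mul _)) (integrable_const _),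
        integral_sub (hg2.const_mul _) (hg.const_mul _), integral_const_mul, integral_const_mul,
        integral_const, smul_eq_mul]
    have h2 : 0 ≤ ∫ x, (M ^ 2 * g x ^ 2 - 2 * M * I * g x + I ^ 2) ∂μ :=
      integral_nonneg fun x => by
        show 0 ≤ M ^ 2 * g x ^ 2 - 2 * M * I * g x + I ^ 2
        nlinarith [sq_nonneg (M * g x - I)]
    rw [h1] at h2
    have h3 : 0 ≤ M * (M * (∫ x, g x ^ 2 ∂μ) - I ^ 2) := by nlinarith
    linarith [nonneg_of_mul_nonneg_right h3 hpos]

theorem sum_Icc_one (N : ℕ) (f : ℕ → ℝ) : ∑ n ∈ Finset.Icc 1 N, f n = ∑ k ∈ Finset.range N,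
    f (k + 1) := by
  induction N with
  | zero => simp
  | succ N ih => rw [Finset.sum_Icc_succ_top (by omega), ih, Finset.sum_range_succ]

/-! ### Stability of `rh` and bounds of the weighted masses. -/

namespace Mesh

variable {d : ℕ} {Ω : Set (Pt d)} (m : Mesh d Ω)

theorem isFiniteMeasure_restrict_patch (i : Fin m.M) :
    IsFiniteMeasure (volume.restrict (m.patch i)) := by
  refine ⟨?_⟩
  rw [Measure.restrict_apply_univ, patch]
  exact (Finset.isCompact_biUnion _ fun K _ => m.isCompact_simplex K).measure_lt_top

theorem integrableOn_patch {f : Pt d → ℝ} (hf : ∀ K, IntegrableOn f (m.simplex K)) (i : Fin m.M) :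
    IntegrableOn f (m.patch i) := by
  rw [IntegrableOn, patch, m.restrict_biUnion_simplex, integrable_finsetSum_measure]
  exact fun K _ => hf K

theorem restrict_patch_le (hΩ : volume (frontier Ω) = 0) (i : Fin m.M) :
    volume.restrict (m.patch i) ≤ volume.restrict Ω := by
  rw [← restrict_closure_eq hΩ]
  exact Measure.restrict_mono (iUnion₂_subset fun K _ => m.simplex_subset K) le_rfl

/-- The operator `r_h` does not increase the `L²` norm. -/
theorem sum_mass_rh_sq_le (hΩ : volume (frontier Ω) = 0) {g : Pt d → ℝ} (hg : IntegrableOn g Ω)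
    (hg2 : IntegrableOn (fun x => g x ^ 2) Ω) :
    ∑ i, m.mass i * m.rh g i ^ 2 ≤ ∫ x in Ω, g x ^ 2 := by
  have hK := m.integrableOn_simplex hΩ hg
  have hK2 := m.integrableOn_simplex hΩ hg2
  have h1 : ∀ i, m.mass i * m.rh g i ^ 2 ≤
      ∑ K ∈ m.star i, 1 / ((d : ℝ) + 1) * ∫ x in m.simplex K, g x ^ 2 := by
    intro i
    have hpos := m.volume_real_patch_pos i
    have := m.isFiniteMeasure_restrict_patch i
    have hJ := sq_integral_le (m.integrableOn_patch hK i) (m.integrableOn_patch hK2 i)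
    rw [measureReal_restrict_apply_univ] at hJ
    rw [rh, setAverage_eq, mass_eq, ← Finset.mul_sum, ← m.integral_patch hK2, smul_eq_mul,
      mul_assoc]
    gcongr
    rw [mul_pow, ← mul_assoc]
    have e : volume.real (m.patch i) * (volume.real (m.patch i))⁻¹ ^ 2 =
        (volume.real (m.patch i))⁻¹ := by
      field_simp
    rwa [e, inv_mul_le_iff₀ hpos]
  refine (Finset.sum_le_sum fun i _ => h1 i).trans (le_of_eq ?_)
  rw [m.sum_star fun K i => 1 / ((d : ℝ) + 1) * ∫ x in m.simplex K, g x ^ 2,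
    m.integral_eq_sum hΩ hK2]
  refine Finset.sum_congr rfl fun K _ => ?_
  simp only [Finset.sum_const, Finset.card_univ, Fintype.card_fin, nsmul_eq_mul, Nat.cast_add,
    Nat.cast_one]
  field_simp

theorem rh_mem_Icc (hΩ : volume (frontier Ω) = 0) (hb : Bornology.IsBounded Ω) {g : Pt d → ℝ}
    (hg : AEStronglyMeasurable g (volume.restrict Ω))
    (h01 : ∀ᵐ x ∂(volume.restrict Ω), g x ∈ Icc (0 : ℝ) 1) (i : Fin m.M) :
    m.rh g i ∈ Icc (0 : ℝ) 1 := by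
  have hfin : IsFiniteMeasure (volume.restrict Ω) := ⟨by simpa using hb.measure_lt_top⟩
  have hint : IntegrableOn g Ω := by
    refine Integrable.of_bound hg 1 (h01.mono fun x hx => ?_)
    rw [Real.norm_eq_abs, abs_of_nonneg hx.1]
    exact hx.2
  have hpos := m.volume_real_patch_pos i
  have hle := m.restrict_patch_le hΩ i
  refine (convex_Icc (0 : ℝ) 1).set_average_mem isClosed_Icc ?_ ?_ (ae_mono hle h01)
    (Integrable.mono_measure hint hle)
  · exact fun h => hpos.ne' (by simp [Measure.real, h])
  · exact fun h => hpos.ne' (by simp [Measure.real, h])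

theorem integral_simplex_mem (hΩ : volume (frontier Ω) = 0) {φ : Pt d → ℝ} {b : ℝ}
    (hφ : ∀ᵐ x ∂(volume.restrict Ω), 0 ≤ φ x ∧ φ x ≤ b) (K : Fin m.L) :
    ∫ x in m.simplex K, φ x ∈ Icc 0 (b * volume.real (m.simplex K)) := by
  have hle : volume.restrict (m.simplex K) ≤ volume.restrict Ω := by
    rw [← restrict_closure_eq hΩ]
    exact Measure.restrict_mono (m.simplex_subset K) le_rfl
  have hφ' := ae_mono hle hφ
  refine ⟨integral_nonneg_of_ae (by filter_upwards [hφ'] with x hx using hx.1), ?_⟩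
  rw [← measureReal_restrict_apply_univ]
  have := isFiniteMeasure_restrict.2 (m.volume_simplex_ne_top K)
  refine (Real.le_norm_self _).trans (norm_integral_le_of_norm_le_const ?_)
  filter_upwards [hφ'] with x hx
  rw [Real.norm_eq_abs, abs_of_nonneg hx.1]
  exact hx.2

theorem massW_nonneg (hΩ : volume (frontier Ω) = 0) {φ : Pt d → ℝ} {b : ℝ}
    (hφ : ∀ᵐ x ∂(volume.restrict Ω), 0 ≤ φ x ∧ φ x ≤ b) (i : Fin m.M) : 0 ≤ m.massW φ i :=
  mul_nonneg (by positivity) (Finset.sum_nonneg fun K _ => (m.integral_simplex_mem hΩ hφ K).1)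

theorem sum_massW_le (hΩ : volume (frontier Ω) = 0) {φ : Pt d → ℝ} {b : ℝ}
    (hφ : ∀ᵐ x ∂(volume.restrict Ω), 0 ≤ φ x ∧ φ x ≤ b) :
    ∑ i, m.massW φ i ≤ b * volume.real Ω := by
  have h1 : ∀ i, m.massW φ i ≤ b * m.mass i := by
    intro i
    rw [massW, mass, mul_left_comm b, Finset.mul_sum _ _ b]
    gcongr with K _
    exact (m.integral_simplex_mem hΩ hφ K).2
  rw [← m.sum_mass hΩ, Finset.mul_sum]
  exact Finset.sum_le_sum fun i _ => h1 i

end Mesh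

/-! ### Time averages and the discrete sources. -/

theorem timeMean_congr {τ : ℝ} {n : ℕ} {f g : ℝ → ℝ} (hτ : 0 ≤ τ)
    (h : ∀ᵐ t ∂(volume.restrict (Ioc (((n : ℝ) - 1) * τ) (n * τ))), f t = g t) :
    timeMean τ f n = timeMean τ g n := by
  have hle : ((n : ℝ) - 1) * τ ≤ n * τ := by nlinarith
  rw [timeMean, timeMean, intervalIntegral.integral_of_le hle, intervalIntegral.integral_of_le hle,
    integral_congr_ae h]

theorem restrict_step_le {T : ℝ} (hT : 0 < T) {N n : ℕ} (hn : n ∈ Finset.Icc 1 N) :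
    volume.restrict (Ioc (((n : ℝ) - 1) * (T / N)) (n * (T / N))) ≤
      volume.restrict (Ioo 0 T) := by
  obtain ⟨h1, h2⟩ := Finset.mem_Icc.1 hn
  have hn1 : (1 : ℝ) ≤ n := by exact_mod_cast h1
  have hnN : (n : ℝ) ≤ N := by exact_mod_cast h2
  have hN : (0 : ℝ) < N := by linarith
  have hb : (n : ℝ) * (T / N) ≤ T := by
    rw [mul_div_assoc', div_le_iff₀ hN, mul_comm]
    gcongr
  have ha : 0 ≤ ((n : ℝ) - 1) * (T / N) := mul_nonneg (by linarith) (by positivity)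
  rw [Measure.restrict_congr_set (Ioo_ae_eq_Ioc (a := (0 : ℝ)) (b := T))]
  exact Measure.restrict_mono (Ioc_subset_Ioc ha hb) le_rfl

namespace Data

variable {d : ℕ} {D : Data d}

theorem Admissible.volume_frontier (hD : D.Admissible) : volume (frontier D.Ω) = 0 :=
  volume_frontier_eq_zero hD.isOpen hD.lipschitz

theorem Admissible.isFiniteMeasure (hD : D.Admissible) :
    IsFiniteMeasure (volume.restrict D.Ω) := ⟨by simpa using hD.isBounded.measure_lt_top⟩

variable {q : ℝ → Pt d → ℝ}

theorem integrable_sq_cyl (hq : MemLp (fun p : ℝ × Pt d => q p.1 p.2) 2 D.cyl) :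
    Integrable (fun p : ℝ × Pt d => q p.1 p.2 ^ 2) D.cyl := hq.integrable_sq

theorem Admissible.integrable_cyl (hD : D.Admissible)
    (hq : MemLp (fun p : ℝ × Pt d => q p.1 p.2) 2 D.cyl) :
    Integrable (fun p : ℝ × Pt d => q p.1 p.2) D.cyl := by
  have := hD.isFiniteMeasure
  have : IsFiniteMeasure D.cyl := by
    unfold cyl
    infer_instance
  exact hq.integrable one_le_two

theorem Admissible.ae_integrableOn (hD : D.Admissible)
    (hq : MemLp (fun p : ℝ × Pt d => q p.1 p.2) 2 D.cyl) :
    ∀ᵐ t ∂(volume.restrict (Ioo 0 D.T)),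
      IntegrableOn (q t) D.Ω ∧ IntegrableOn (fun x => q t x ^ 2) D.Ω := by
  have := hD.isFiniteMeasure
  exact (hD.integrable_cyl hq).prod_right_ae.and (integrable_sq_cyl hq).prod_right_ae

theorem Admissible.integrable_sq_slice (hD : D.Admissible)
    (hq : MemLp (fun p : ℝ × Pt d => q p.1 p.2) 2 D.cyl) :
    Integrable (fun t => ∫ x in D.Ω, q t x ^ 2) (volume.restrict (Ioo 0 D.T)) := by
  have := hD.isFiniteMeasure
  exact (integrable_sq_cyl hq).integral_prod_left

theorem Admissible.integrable_rh (hD : D.Admissible) (m : Mesh d D.Ω)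
    (hq : MemLp (fun p : ℝ × Pt d => q p.1 p.2) 2 D.cyl) (i : Fin m.M) :
    Integrable (fun t => m.rh (q t) i) (volume.restrict (Ioo 0 D.T)) := by
  have := hD.isFiniteMeasure
  have := m.isFiniteMeasure_restrict_patch i
  have h1 : Integrable (fun p : ℝ × Pt d => q p.1 p.2)
      ((volume.restrict (Ioo 0 D.T)).prod (volume.restrict (m.patch i))) :=
    (hD.integrable_cyl hq).mono_measure
      (Measure.prod_mono le_rfl (m.restrict_patch_le hD.volume_frontier i))
  simp_rw [Mesh.rh, setAverage_eq, smul_eq_mul]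
  exact h1.integral_prod_left.const_mul _

/-- Domination: up to the factor `m.mass i`, this square is one term of the sum bounded by the
squared L² norm of the time slice. -/
theorem Admissible.integrable_rh_sq (hD : D.Admissible) (m : Mesh d D.Ω)
    (hq : MemLp (fun p : ℝ × Pt d => q p.1 p.2) 2 D.cyl) (i : Fin m.M) :
    Integrable (fun t => m.rh (q t) i ^ 2) (volume.restrict (Ioo 0 D.T)) := by
  have hm := m.mass_pos i
  refine ((hD.integrable_sq_slice hq).const_mul (m.mass i)⁻¹).mono'
    ((hD.integrable_rh m hq i).1.pow 2) ?_
  filter_upwards [hD.ae_integrableOn hq] with t ht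
  rw [Real.norm_eq_abs, abs_of_nonneg (sq_nonneg _), ← div_eq_inv_mul, le_div_iff₀ hm, mul_comm]
  refine le_trans ?_ (m.sum_mass_rh_sq_le hD.volume_frontier ht.1 ht.2)
  exact Finset.single_le_sum (f := fun i => m.mass i * m.rh (q t) i ^ 2)
    (fun j _ => mul_nonneg (m.mass_pos j).le (sq_nonneg _)) (Finset.mem_univ i)

theorem Admissible.timeMean_rhCorr (hD : D.Admissible) (m : Mesh d D.Ω)
    (hq : MemLp (fun p : ℝ × Pt d => q p.1 p.2) 2 D.cyl) {N n : ℕ} (hn : n ∈ Finset.Icc 1 N)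
    (i : Fin m.M) :
    timeMean (D.T / N) (fun t => m.rhCorr (q t) i) n =
      timeMean (D.T / N) (fun t => m.rh (q t) i) n := by
  have hT := hD.T_pos
  refine timeMean_congr (by positivity) (ae_mono (restrict_step_le hT hn) ?_)
  filter_upwards [hD.ae_integrableOn hq] with t ht
  exact m.rhCorr_eq_rh hD.volume_frontier ht.1 i

/-- The discrete sources have the same total mass as the exact ones. -/
theorem Admissible.sum_mass_timeMean (hD : D.Admissible) (m : Mesh d D.Ω)
    (hq : MemLp (fun p : ℝ × Pt d => q p.1 p.2) 2 D.cyl) {N n : ℕ} (hn : n ∈ Finset.Icc 1 N) :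
    ∑ i, m.mass i * timeMean (D.T / N) (fun t => m.rhCorr (q t) i) n =
      timeMean (D.T / N) (fun t => ∫ x in D.Ω, q t x) n := by
  have hT := hD.T_pos
  have hstep := restrict_step_le hT hn
  have hle : ((n : ℝ) - 1) * (D.T / N) ≤ n * (D.T / N) :=
    mul_le_mul_of_nonneg_right (by linarith) (by positivity)
  have h1 : timeMean (D.T / N) (fun t => ∫ x in D.Ω, q t x) n =
      timeMean (D.T / N) (fun t => ∑ i, m.mass i * m.rh (q t) i) n := by
    refine timeMean_congr (by positivity) (ae_mono hstep ?_)
    filter_upwards [hD.ae_integrableOn hq] with t ht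
    exact (m.sum_mass_rh hD.volume_frontier ht.1).symm
  simp_rw [hD.timeMean_rhCorr m hq hn]
  rw [h1]
  simp_rw [timeMean, intervalIntegral.integral_of_le hle]
  rw [integral_finsetSum _ fun i _ =>
    ((hD.integrable_rh m hq i).mono_measure hstep).const_mul (m.mass i), Finset.mul_sum]
  refine Finset.sum_congr rfl fun i _ => ?_
  rw [integral_const_mul]
  ring

/-- Bound of the discrete sources in `L²`. -/
theorem Admissible.sum_timeMean_sq_le (hD : D.Admissible) (m : Mesh d D.Ω)
    (hq : MemLp (fun p : ℝ × Pt d => q p.1 p.2) 2 D.cyl) {N : ℕ} (hN : 1 ≤ N) :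
    (D.T / N) * ∑ n ∈ Finset.Icc 1 N, ∑ i,
      m.mass i * timeMean (D.T / N) (fun t => m.rhCorr (q t) i) n ^ 2 ≤
      ∫ t in (0 : ℝ)..D.T, ∫ x in D.Ω, q t x ^ 2 := by
  have hT := hD.T_pos
  have hN0 : (0 : ℝ) < N := by exact_mod_cast hN
  set τ := D.T / N with hτ
  have hτ0 : 0 < τ := by positivity
  have hslice := hD.integrable_sq_slice hq
  have hstep : ∀ n ∈ Finset.Icc 1 N,
      τ * ∑ i, m.mass i * timeMean τ (fun t => m.rhCorr (q t) i) n ^ 2 ≤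
        ∫ t in (((n : ℝ) - 1) * τ)..(n * τ), ∫ x in D.Ω, q t x ^ 2 := by
    intro n hn
    have hμ := restrict_step_le hT hn
    rw [← hτ] at hμ
    have hle : ((n : ℝ) - 1) * τ ≤ n * τ := mul_le_mul_of_nonneg_right (by linarith) hτ0.le
    -- Cauchy–Schwarz on a time interval of length τ.
    have h1 : ∀ i, τ * timeMean τ (fun t => m.rhCorr (q t) i) n ^ 2 ≤
        ∫ t in Ioc (((n : ℝ) - 1) * τ) (n * τ), m.rh (q t) i ^ 2 := by
      intro i
      rw [hτ, hD.timeMean_rhCorr m hq hn i, ← hτ, timeMean, intervalIntegral.integral_of_le hle]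
      have hJ := sq_integral_le ((hD.integrable_rh m hq i).mono_measure hμ)
        ((hD.integrable_rh_sq m hq i).mono_measure hμ)
      rw [measureReal_restrict_apply_univ, Real.volume_real_Ioc_of_le hle] at hJ
      have e : (n : ℝ) * τ - (n - 1) * τ = τ := by ring
      rw [e] at hJ
      have e2 : ∀ I : ℝ, τ * (1 / τ * I) ^ 2 = τ⁻¹ * I ^ 2 := fun I => by field_simp
      rwa [e2, inv_mul_le_iff₀ hτ0]
    calc τ * ∑ i, m.mass i * timeMean τ (fun t => m.rhCorr (q t) i) n ^ 2
        = ∑ i, m.mass i * (τ * timeMean τ (fun t => m.rhCorr (q t) i) n ^ 2) := by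
          rw [Finset.mul_sum]
          exact Finset.sum_congr rfl fun i _ => by ring
      _ ≤ ∑ i, m.mass i * ∫ t in Ioc (((n : ℝ) - 1) * τ) (n * τ), m.rh (q t) i ^ 2 :=
          Finset.sum_le_sum fun i _ => mul_le_mul_of_nonneg_left (h1 i) (m.mass_pos i).le
      _ = ∫ t in Ioc (((n : ℝ) - 1) * τ) (n * τ), ∑ i, m.mass i * m.rh (q t) i ^ 2 := by
          rw [integral_finsetSum _ fun i _ =>
            ((hD.integrable_rh_sq m hq i).mono_measure hμ).const_mul (m.mass i)]
          simp_rw [integral_const_mul]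
      _ ≤ ∫ t in Ioc (((n : ℝ) - 1) * τ) (n * τ), ∫ x in D.Ω, q t x ^ 2 := by
          refine integral_mono_ae (integrable_finsetSum _ fun i _ =>
            ((hD.integrable_rh_sq m hq i).mono_measure hμ).const_mul (m.mass i))
            (hslice.mono_measure hμ) (ae_mono hμ ?_)
          filter_upwards [hD.ae_integrableOn hq] with t ht
          exact m.sum_mass_rh_sq_le hD.volume_frontier ht.1 ht.2
      _ = _ := (intervalIntegral.integral_of_le hle).symm
  rw [Finset.mul_sum]
  refine (Finset.sum_le_sum hstep).trans (le_of_eq ?_)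
  rw [sum_Icc_one]
  have hadj := intervalIntegral.sum_integral_adjacent_intervals (n := N) (μ := volume)
    (f := fun t => ∫ x in D.Ω, q t x ^ 2) (a := fun k : ℕ => (k : ℝ) * τ) fun k hk => ?_
  · simp only [Nat.cast_zero, zero_mul] at hadj
    have e : (N : ℝ) * τ = D.T := by rw [hτ]; field_simp
    rw [e] at hadj
    rw [← hadj]
    refine Finset.sum_congr rfl fun k _ => ?_
    push_cast
    rw [add_sub_cancel_right]
  · have hμ := restrict_step_le hT (N := N) (n := k + 1) (Finset.mem_Icc.2 ⟨by omega, by omega⟩)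
    rw [← hτ] at hμ
    push_cast at hμ
    rw [add_sub_cancel_right] at hμ
    rw [intervalIntegrable_iff_integrableOn_Ioc_of_le (by push_cast; nlinarith)]
    have := hslice.mono_measure hμ
    simpa [IntegrableOn] using this

end Data

/-! ### The capillary energy and the global pressure -/

/-- A primitive of `κ - p`, for a nonincreasing function `p`, satisfies the inequality of
convexity. -/
theorem exists_primitive_le {p : ℝ → ℝ} (hp : Antitone p) (hc : Continuous p) (κ : ℝ) :
    ∃ G : ℝ → ℝ, G (1 / 2) = 0 ∧ ∀ s s', G s - G s' ≤ (κ - p s) * (s - s') := by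
  have hint : ∀ a b : ℝ, IntervalIntegrable (fun x => κ - p x) volume a b := fun a b =>
    (continuous_const.sub hc).intervalIntegrable a b
  refine ⟨fun s => ∫ x in (1 / 2 : ℝ)..s, (κ - p x), intervalIntegral.integral_same,
    fun s s' => ?_⟩
  simp only
  rw [intervalIntegral.integral_interval_sub_left (hint _ _) (hint _ _)]
  rcases le_total s' s with h | h
  · have := intervalIntegral.integral_mono_on h (hint s' s)
      (intervalIntegrable_const (c := κ - p s))
      fun x hx => sub_le_sub_left (hp hx.2) κ
    rw [intervalIntegral.integral_const, smul_eq_mul] at this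
    linarith
  · have := intervalIntegral.integral_mono_on h
      (intervalIntegrable_const (c := κ - p s)) (hint s s')
      fun x hx => sub_le_sub_left (hp hx.1) κ
    rw [intervalIntegral.integral_const, smul_eq_mul] at this
    rw [intervalIntegral.integral_symm]
    linarith

/-- The integral of a nonincreasing function `f` with respect to the continuous nonincreasing
function `p`. -/
theorem exists_stieltjes_integral {f p : ℝ → ℝ} (hf : Antitone f) (hp : Antitone p)
    (hc : Continuous p) :
    ∃ A : ℝ → ℝ, A 0 = 0 ∧ ∀ s t, s ≤ t →
      f t * (p s - p t) ≤ A s - A t ∧ A s - A t ≤ f s * (p s - p t) := by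
  -- The measure of -p plays the role of -p'(x) dx; continuity and monotonicity of p suffice.
  let F : StieltjesFunction ℝ :=
    { toFun := fun x => -p x
      mono' := fun _ _ h => neg_le_neg (hp h)
      right_continuous' := fun x => hc.neg.continuousWithinAt }
  have hint : ∀ a b : ℝ, IntervalIntegrable f F.measure a b := fun a b => hf.intervalIntegrable
  have hmeas : ∀ {s t : ℝ}, s ≤ t → F.measure.real (Ioc s t) = p s - p t := by
    intro s t hst
    have e : F t - F s = p s - p t := by
      change -p t - -p s = _
      ring
    rw [Measure.real, F.measure_Ioc, e, ENNReal.toReal_ofReal (sub_nonneg.2 (hp hst))]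
  -- Integrating from s up to 0 gives A(0) = 0 and dA = f dp; for f = f_o this is the correction
  -- that turns P_w into the global pressure.
  refine ⟨fun s => ∫ x in s..0, f x ∂F.measure, intervalIntegral.integral_same,
    fun s t hst => ?_⟩
  simp only
  rw [← intervalIntegral.integral_add_adjacent_intervals (hint s t) (hint t 0),
    add_sub_cancel_right, intervalIntegral.integral_of_le hst]
  have hfin : F.measure (Ioc s t) ≠ ⊤ := by rw [F.measure_Ioc]; finiteness
  have hfI : IntegrableOn f (Ioc s t) F.measure := (hint s t).1
  constructor
  · have := setIntegral_mono_on (integrableOn_const hfin (C := f t)) hfI measurableSet_Ioc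
      fun x hx => hf hx.2
    rw [setIntegral_const, hmeas hst, smul_eq_mul] at this
    linarith
  · have := setIntegral_mono_on hfI (integrableOn_const hfin (C := f s)) measurableSet_Ioc
      fun x hx => hf hx.1.le
    rw [setIntegral_const, hmeas hst, smul_eq_mul] at this
    linarith

theorem upwindW_comm (a b x y : ℝ) : upwindW a b x y = upwindW b a y x := by
  unfold upwindW
  rcases lt_trichotomy x y with h | h | h
  · simp [h, h.not_gt]
  · simp [h, max_comm]
  · simp [h, h.not_gt]

theorem upwindO_comm (a b x y : ℝ) : upwindO a b x y = upwindO b a y x := by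
  unfold upwindO
  rcases lt_trichotomy x y with h | h | h
  · simp [h, h.not_gt]
  · simp [h, min_comm]
  · simp [h, h.not_gt]

/-- If `|z|` is at most the convex combination of `|x|` and `|y|` with weights proportional to `w`
and `o`, then the square of `z` is bounded by the weighted squares of `x` and `y`. -/
theorem mul_sq_le_of_mul_abs_le {w o η x y z : ℝ} (hw : 0 ≤ w) (ho : 0 ≤ o) (hη : 0 < η)
    (hwo : η ≤ w + o) (hz : (w + o) * |z| ≤ w * |x| + o * |y|) :
    η * z ^ 2 ≤ w * x ^ 2 + o * y ^ 2 := by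
  have hpos : 0 < w + o := by linarith
  have h1 : (w + o) * ((w + o) * |z| ^ 2) ≤ (w + o) * (w * |x| ^ 2 + o * |y| ^ 2) := by
    have h2 : ((w + o) * |z|) ^ 2 ≤ (w * |x| + o * |y|) ^ 2 := by gcongr
    nlinarith [mul_nonneg (mul_nonneg hw ho) (sq_nonneg (|x| - |y|))]
  have h3 := le_of_mul_le_mul_left h1 hpos
  simp only [sq_abs] at h3
  nlinarith [sq_nonneg z]

/-- The increments of the global pressure are controlled by those of the phase pressures, weighted
by the upwind mobilities. -/
theorem globalPressure_sq_le {w o p A : ℝ → ℝ} {η : ℝ} (hw : ∀ s, 0 ≤ w s)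
    (ho : ∀ s, 0 ≤ o s) (hη : 0 < η) (hwo : ∀ s, η ≤ w s + o s)
    (hp : Antitone p)
    (hA : ∀ s t, s ≤ t → o t / (w t + o t) * (p s - p t) ≤ A s - A t ∧
      A s - A t ≤ o s / (w s + o s) * (p s - p t)) (a b P Q : ℝ) :
    η * (P + A a - (Q + A b)) ^ 2 ≤ w (upwindW a b P Q) * (P - Q) ^ 2 +
      o (upwindO a b (P + p a) (Q + p b)) * (P + p a - (Q + p b)) ^ 2 := by
  -- The upwind values are symmetric under exchange of the two nodes, so a may be taken as the
  -- larger saturation.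
  wlog hba : b ≤ a generalizing a b P Q
  · have h := this b a Q P (le_of_not_ge hba)
    rw [upwindW_comm b a, upwindO_comm b a] at h
    linarith
  obtain ⟨h1, h2⟩ := hA b a hba
  have hδ : 0 ≤ p b - p a := sub_nonneg.2 (hp hba)
  have hTa : 0 < w a + o a := hη.trans_le (hwo a)
  have hTb : 0 < w b + o b := hη.trans_le (hwo b)
  rw [div_mul_eq_mul_div, div_le_iff₀ hTa] at h1
  rw [div_mul_eq_mul_div, le_div_iff₀ hTb] at h2
  set δ := p b - p a with hδd
  set x := P - Q with hx
  set e := A b - A a with he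
  have hy : P + p a - (Q + p b) = x - δ := by rw [hx, hδd]; ring
  have hz : P + A a - (Q + A b) = x - e := by rw [hx, he]; ring
  have he0 : 0 ≤ e := by
    by_contra hneg
    nlinarith [mul_nonneg (ho a) hδ, mul_pos (neg_pos.2 (not_le.1 hneg)) hTa]
  have heδ : e ≤ δ := by
    by_contra hneg
    nlinarith [mul_nonneg (hw b) hδ, mul_pos (sub_pos.2 (not_le.1 hneg)) hTb]
  rw [hy, hz]
  -- Three cases according to the signs of x (wetting) and x - δ (non-wetting). If both are positive
  -- or both negative, both mobilities are taken at the same node, and `h1` respectively `h2` bounds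
  -- |z| by the corresponding weighted mean of |x| and |x - δ|.
  rcases lt_or_ge 0 (x - δ) with hy0 | hy0
  · have hx0 : 0 < x := by linarith
    have hW : upwindW a b P Q = a := if_pos (by linarith)
    have hO : upwindO a b (P + p a) (Q + p b) = a := if_pos (by linarith)
    rw [hW, hO]
    refine mul_sq_le_of_mul_abs_le (hw a) (ho a) hη (hwo a) ?_
    rw [abs_of_pos hx0, abs_of_pos hy0, abs_of_nonneg (by linarith)]
    nlinarith
  · rcases lt_or_ge x 0 with hx0 | hx0
    · have hy1 : x - δ < 0 := by linarith
      have hW : upwindW a b P Q = b := by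
        rw [upwindW, if_neg (by linarith), if_pos (by linarith)]
      have hO : upwindO a b (P + p a) (Q + p b) = b := by
        rw [upwindO, if_neg (by linarith), if_pos (by linarith)]
      rw [hW, hO]
      refine mul_sq_le_of_mul_abs_le (hw b) (ho b) hη (hwo b) ?_
      rw [abs_of_neg hx0, abs_of_neg hy1, abs_of_nonpos (by linarith)]
      nlinarith
    -- Opposite or zero drops: the wetting mobility is taken at a and the non-wetting one at b. The
    -- tie rules, maximum for w and minimum for o, select these same nodes. According to the sign of
    -- z, one of the two terms alone suffices.
    · have hW : upwindW a b P Q = a := by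
        rw [upwindW]
        split_ifs with h3 h4
        · rfl
        · linarith
        · exact max_eq_left hba
      have hO : upwindO a b (P + p a) (Q + p b) = b := by
        rw [upwindO]
        split_ifs with h3 h4
        · linarith
        · rfl
        · exact min_eq_right hba
      rw [hW, hO]
      have hwx : 0 ≤ w a * x ^ 2 := mul_nonneg (hw a) (sq_nonneg _)
      have hoy : 0 ≤ o b * (x - δ) ^ 2 := mul_nonneg (ho b) (sq_nonneg _)
      rcases le_total 0 (x - e) with hz0 | hz0
      · have h := mul_sq_le_of_mul_abs_le (y := 0) (x := x) (z := x - e) (hw a) (ho a) hη (hwo a) ?_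
        · linarith
        · rw [abs_of_nonneg hx0, abs_of_nonneg hz0, abs_zero]
          nlinarith [mul_nonneg (ho a) (neg_nonneg.2 hy0)]
      · have h := mul_sq_le_of_mul_abs_le (y := x - δ) (x := 0) (z := x - e)
          (hw b) (ho b) hη (hwo b) ?_
        · linarith
        · rw [abs_of_nonpos hy0, abs_of_nonpos hz0, abs_zero]
          nlinarith [mul_nonneg (hw b) hx0]

/-! ### The discrete energy balance -/

section Network

variable {ι : Type*} [Fintype ι] {k : ι → ι → ℝ}

/-- Conservation: the flux between two nodes is antisymmetric. -/
theorem sum_flux_eq_zero (hk : ∀ i j, k i j = k j i) (P : ι → ℝ) :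
    ∑ i, ∑ j, k i j * (P j - P i) = 0 := by
  have h : ∑ i, ∑ j, k i j * (P j - P i) = -∑ i, ∑ j, k i j * (P j - P i) := by
    conv_lhs => rw [Finset.sum_comm]
    simp_rw [← Finset.sum_neg_distrib]
    refine Finset.sum_congr rfl fun i _ => Finset.sum_congr rfl fun j _ => ?_
    rw [hk j i]
    ring
  linarith

theorem sum_flux_mul (hk : ∀ i j, k i j = k j i) (P : ι → ℝ) :
    ∑ i, (∑ j, k i j * (P j - P i)) * P i = -(1 / 2 * ∑ i, ∑ j, k i j * (P i - P j) ^ 2) := by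
  have h : ∑ i, ∑ j, k i j * (P i - P j) ^ 2 =
      -(∑ i, ∑ j, k i j * (P j - P i) * P i) - ∑ i, ∑ j, k i j * (P j - P i) * P i := by
    have h2 : ∑ i, ∑ j, k i j * (P j - P i) * P i = ∑ i, ∑ j, k i j * (P i - P j) * P j := by
      rw [Finset.sum_comm]
      exact Finset.sum_congr rfl fun i _ => Finset.sum_congr rfl fun j _ => by rw [hk j i]
    conv_rhs => rw [h2]
    conv_rhs => enter [1]; rw [← h2]
    simp_rw [← Finset.sum_neg_distrib, ← Finset.sum_sub_distrib]
    exact Finset.sum_congr rfl fun i _ => Finset.sum_congr rfl fun j _ => by ring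
  simp_rw [Finset.sum_mul]
  rw [h]
  ring

end Network

/-- Used to recover the wetting equation at the last node, where the scheme does not impose it. -/
theorem eq_zero_of_sum_eq_zero {M : ℕ} {R : Fin M → ℝ} (h : ∀ i : Fin M, (i : ℕ) + 1 < M → R i = 0)
    (hsum : ∑ i, R i = 0) (i : Fin M) : R i = 0 := by
  by_cases hi : (i : ℕ) + 1 < M
  · exact h i hi
  · rw [← hsum, Finset.sum_eq_single i]
    · intro j _ hj
      refine h j ?_
      have := i.2
      have := j.2
      have : (j : ℕ) ≠ i := fun e => hj (Fin.ext e)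
      omega
    · simp

/-- The equations are tested with the pressures of their own phases. Replacing `Po` by `Pw + p`
leaves the accumulation X multiplied by the capillary pressure only. -/
theorem energy_identity {ι : Type*} [Fintype ι] {kw ko : ι → ι → ℝ} {X a b p Pw Po : ι → ℝ}
    (hkw : ∀ i j, kw i j = kw j i) (hko : ∀ i j, ko i j = ko j i)
    (hW : ∀ i, X i - ∑ j, kw i j * (Pw j - Pw i) = a i)
    (hO : ∀ i, -X i - ∑ j, ko i j * (Po j - Po i) = b i) (hcap : ∀ i, Po i - Pw i = p i) :
    1 / 2 * ∑ i, ∑ j, (kw i j * (Pw i - Pw j) ^ 2 + ko i j * (Po i - Po j) ^ 2) =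
      ∑ i, ((a i + b i) * Pw i + b i * p i + X i * p i) := by
  have h1 := sum_flux_mul hkw Pw
  have h2 := sum_flux_mul hko Po
  have e1 : ∀ i, ∑ j, kw i j * (Pw j - Pw i) = X i - a i := fun i => by linarith [hW i]
  have e2 : ∀ i, ∑ j, ko i j * (Po j - Po i) = -X i - b i := fun i => by linarith [hO i]
  simp_rw [e1] at h1
  simp_rw [e2] at h2
  have h3 : ∑ i, ((a i + b i) * Pw i + b i * p i + X i * p i) =
      -(∑ i, (X i - a i) * Pw i) - ∑ i, (-X i - b i) * Po i := by
    rw [← Finset.sum_neg_distrib, ← Finset.sum_sub_distrib]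
    refine Finset.sum_congr rfl fun i _ => ?_
    rw [← hcap i]
    ring
  rw [h3, h1, h2]
  simp_rw [Finset.sum_add_distrib]
  ring

/-- Young's inequality with the free parameter l treats the term in V. The other three have factors
bounded by 2P, P and P in front of at most |q| + |q'| ≤ 1 + (q² + q'²)/2, whence 4P and 2P. -/
theorem source_term_le {α β q q' V A p κ P l : ℝ} (hα : α ∈ Icc (0 : ℝ) 1) (hβ : β ∈ Icc (0 : ℝ) 1)
    (hA : |A| ≤ 2 * P) (hp : |p| ≤ P) (hκ : |κ| ≤ P) (hl : 0 < l) :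
    (q - q') * (V - A) + ((1 - α) * q - (1 - β) * q') * p + κ * (α * q - β * q') ≤
      (2 * l + 2 * P) * (q ^ 2 + q' ^ 2) + 4 * P + (4 * l)⁻¹ * V ^ 2 := by
  have hP : 0 ≤ P := (abs_nonneg _).trans hp
  have hs : |q| + |q'| ≤ 1 + (q ^ 2 + q' ^ 2) / 2 := by
    nlinarith [sq_nonneg (|q| - 1), sq_nonneg (|q'| - 1), sq_abs q, sq_abs q']
  have hs0 : 0 ≤ |q| + |q'| := by positivity
  have hcomb : ∀ x y : ℝ, x ∈ Icc (0 : ℝ) 1 → y ∈ Icc (0 : ℝ) 1 →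
      |x * q - y * q'| ≤ |q| + |q'| := fun x y hx hy => by
    refine (abs_sub _ _).trans ?_
    rw [abs_mul, abs_mul, abs_of_nonneg hx.1, abs_of_nonneg hy.1]
    nlinarith [abs_nonneg q, abs_nonneg q', hx.2, hy.2]
  have hmul : ∀ x y B : ℝ, |x| ≤ |q| + |q'| → |y| ≤ B → x * y ≤ (|q| + |q'|) * B :=
    fun x y B hx hy => (le_abs_self _).trans (by
      rw [abs_mul]
      exact mul_le_mul hx hy (abs_nonneg _) hs0)
  have h1 : (q - q') * V ≤ l * (q - q') ^ 2 + (4 * l)⁻¹ * V ^ 2 := by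
    have e : l * (q - q') ^ 2 + (4 * l)⁻¹ * V ^ 2 - (q - q') * V =
        (4 * l)⁻¹ * (2 * l * (q - q') - V) ^ 2 := by
      field_simp
      ring
    have : 0 ≤ (4 * l)⁻¹ * (2 * l * (q - q') - V) ^ 2 := by positivity
    linarith
  have h2 : l * (q - q') ^ 2 ≤ l * (2 * (q ^ 2 + q' ^ 2)) := by
    gcongr
    nlinarith [sq_nonneg (q + q')]
  have h3 := hmul (q - q') (-A) (2 * P) (abs_sub _ _) (by rwa [abs_neg])
  have h4 := hmul ((1 - α) * q - (1 - β) * q') p P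
    (hcomb _ _ ⟨by linarith [hα.2], by linarith [hα.1]⟩ ⟨by linarith [hβ.2], by linarith [hβ.1]⟩) hp
  have h5 := hmul (α * q - β * q') κ P (hcomb _ _ hα hβ) hκ
  nlinarith [mul_le_mul_of_nonneg_left hs hP]

/-- The energy estimate for one time step. -/
theorem step_energy_le {ι : Type*} [Fintype ι] {c : ι → ι → ℝ} {μ ν S S' Pw Po α β q q' : ι → ℝ}
    {w o p A G : ℝ → ℝ} {η τ P C κ : ℝ}
    (hc : ∀ i j, 0 ≤ c i j) (hcc : ∀ i j, c i j = c j i) (hμ : ∀ i, 0 ≤ μ i) (hν : ∀ i, 0 ≤ ν i)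
    (hτ : 0 < τ) (hw : ∀ s, 0 ≤ w s) (ho : ∀ s, 0 ≤ o s) (hη : 0 < η)
    (hwo : ∀ s, η ≤ w s + o s) (hp : Antitone p) (hpP : ∀ s, |p s| ≤ P) (hκ : |κ| ≤ P)
    (hA : ∀ s t, s ≤ t → o t / (w t + o t) * (p s - p t) ≤ A s - A t ∧
      A s - A t ≤ o s / (w s + o s) * (p s - p t)) (hAP : ∀ s, |A s| ≤ 2 * P)
    (hG : ∀ s s', G s - G s' ≤ (κ - p s) * (s - s'))
    (hα : ∀ i, α i ∈ Icc (0 : ℝ) 1) (hβ : ∀ i, β i ∈ Icc (0 : ℝ) 1)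
    (hbal : ∑ i, μ i * q i = ∑ i, μ i * q' i)
    (hC : 0 ≤ C)
    (hpoinc : ∀ U : ι → ℝ, ∃ k : ℝ,
      ∑ i, μ i * (U i - k) ^ 2 ≤ C * ∑ i, ∑ j, c i j * (U i - U j) ^ 2)
    (hW : ∀ i, ν i / τ * (S i - S' i) -
      ∑ j, c i j * w (upwindW (S i) (S j) (Pw i) (Pw j)) * (Pw j - Pw i) =
        μ i * (α i * q i - β i * q' i))
    (hO : ∀ i, -(ν i / τ) * (S i - S' i) -
      ∑ j, c i j * o (upwindO (S i) (S j) (Po i) (Po j)) * (Po j - Po i) =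
        μ i * ((1 - α i) * q i - (1 - β i) * q' i))
    (hcap : ∀ i, Po i - Pw i = p (S i)) :
    τ * ∑ i, ∑ j, c i j * (w (upwindW (S i) (S j) (Pw i) (Pw j)) * (Pw i - Pw j) ^ 2 +
        o (upwindO (S i) (S j) (Po i) (Po j)) * (Po i - Po j) ^ 2) ≤
      4 * ((2 * ((C + 1) / η) + 2 * P) *
          (τ * ∑ i, μ i * q i ^ 2 + τ * ∑ i, μ i * q' i ^ 2) +
        4 * P * (∑ i, μ i) * τ - (∑ i, ν i * G (S i) - ∑ i, ν i * G (S' i))) := by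
  set E := ∑ i, ∑ j, c i j * (w (upwindW (S i) (S j) (Pw i) (Pw j)) * (Pw i - Pw j) ^ 2 +
        o (upwindO (S i) (S j) (Po i) (Po j)) * (Po i - Po j) ^ 2) with hE
  -- With this l the Poincaré and global pressure bounds give N2 ≤ l E, so Young's inequality leaves
  -- only E/4 to absorb. The 1 added to C keeps l positive.
  set l := (C + 1) / η with hl
  have hl0 : 0 < l := by positivity
  have hkw : ∀ i j, c i j * w (upwindW (S i) (S j) (Pw i) (Pw j)) =
      c j i * w (upwindW (S j) (S i) (Pw j) (Pw i)) := fun i j => by rw [hcc, upwindW_comm]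
  have hko : ∀ i j, c i j * o (upwindO (S i) (S j) (Po i) (Po j)) =
      c j i * o (upwindO (S j) (S i) (Po j) (Po i)) := fun i j => by rw [hcc, upwindO_comm]
  obtain ⟨k, hk⟩ := hpoinc fun i => Pw i + A (S i)
  set N2 := ∑ i, μ i * (Pw i + A (S i) - k) ^ 2 with hN2
  -- the total accumulation equals the total source
  have hX : ∑ i, ν i / τ * (S i - S' i) = ∑ i, μ i * (α i * q i - β i * q' i) := by
    have h := sum_flux_eq_zero hkw Pw
    rw [← Finset.sum_congr rfl fun i _ => hW i, Finset.sum_sub_distrib, h, sub_zero]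
  have hid := energy_identity (X := fun i => ν i / τ * (S i - S' i))
    (b := fun i => μ i * ((1 - α i) * q i - (1 - β i) * q' i)) hkw hko hW
    (fun i => by rw [← hO i]; ring) hcap
  have hEid : 1 / 2 * E = ∑ i, ((μ i * (α i * q i - β i * q' i) +
      μ i * ((1 - α i) * q i - (1 - β i) * q' i)) * Pw i +
      μ i * ((1 - α i) * q i - (1 - β i) * q' i) * p (S i) +
      ν i / τ * (S i - S' i) * p (S i)) := by
    rw [← hid, hE]
    congr 1
    exact Finset.sum_congr rfl fun i _ => Finset.sum_congr rfl fun j _ => by ring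
  -- Subtracting k from the global pressure is free because the sources balance; inserting κ is free
  -- because total accumulation equals total source (`hX`).
  have hsplit : 1 / 2 * E = ∑ i, μ i * ((q i - q' i) * ((Pw i + A (S i) - k) - A (S i)) +
      ((1 - α i) * q i - (1 - β i) * q' i) * p (S i) + κ * (α i * q i - β i * q' i)) -
      ∑ i, ν i / τ * ((κ - p (S i)) * (S i - S' i)) := by
    have hb : ∑ i, k * (μ i * q i - μ i * q' i) = 0 := by
      rw [← Finset.mul_sum, Finset.sum_sub_distrib, hbal, sub_self, mul_zero]
    have hX' : ∑ i, κ * (ν i / τ * (S i - S' i)) - ∑ i, κ * (μ i * (α i * q i - β i * q' i)) =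
        0 := by
      rw [← Finset.mul_sum, ← Finset.mul_sum, hX, sub_self]
    have e : ∀ i, (μ i * (α i * q i - β i * q' i) +
        μ i * ((1 - α i) * q i - (1 - β i) * q' i)) * Pw i +
        μ i * ((1 - α i) * q i - (1 - β i) * q' i) * p (S i) +
        ν i / τ * (S i - S' i) * p (S i) =
        μ i * ((q i - q' i) * ((Pw i + A (S i) - k) - A (S i)) +
        ((1 - α i) * q i - (1 - β i) * q' i) * p (S i) + κ * (α i * q i - β i * q' i)) -
        ν i / τ * ((κ - p (S i)) * (S i - S' i)) + k * (μ i * q i - μ i * q' i) +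
        (κ * (ν i / τ * (S i - S' i)) - κ * (μ i * (α i * q i - β i * q' i))) :=
      fun i => by ring
    rw [hEid, Finset.sum_congr rfl fun i _ => e i, Finset.sum_add_distrib, Finset.sum_add_distrib,
      Finset.sum_sub_distrib, hb, Finset.sum_sub_distrib, hX', add_zero, add_zero]
  have hsrc : ∑ i, μ i * ((q i - q' i) * ((Pw i + A (S i) - k) - A (S i)) +
      ((1 - α i) * q i - (1 - β i) * q' i) * p (S i) + κ * (α i * q i - β i * q' i)) ≤
      (2 * l + 2 * P) * (∑ i, μ i * q i ^ 2 + ∑ i, μ i * q' i ^ 2) + 4 * P * (∑ i, μ i) +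
        (4 * l)⁻¹ * N2 := by
    rw [hN2, ← Finset.sum_add_distrib]
    simp_rw [Finset.mul_sum, ← Finset.sum_add_distrib]
    refine Finset.sum_le_sum fun i _ => ?_
    refine (mul_le_mul_of_nonneg_left (source_term_le (hα i) (hβ i) (hAP (S i)) (hpP (S i)) hκ hl0)
      (hμ i)).trans (le_of_eq ?_)
    ring
  have hGsum : τ⁻¹ * (∑ i, ν i * G (S i) - ∑ i, ν i * G (S' i)) ≤
      ∑ i, ν i / τ * ((κ - p (S i)) * (S i - S' i)) := by
    rw [← Finset.sum_sub_distrib, Finset.mul_sum]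
    refine Finset.sum_le_sum fun i _ => ?_
    have := mul_le_mul_of_nonneg_left (hG (S i) (S' i)) (div_nonneg (hν i) hτ.le)
    refine le_trans (le_of_eq ?_) this
    ring
  have hglob : η * ∑ i, ∑ j, c i j * (Pw i + A (S i) - (Pw j + A (S j))) ^ 2 ≤ E := by
    rw [hE]
    simp_rw [Finset.mul_sum]
    refine Finset.sum_le_sum fun i _ => Finset.sum_le_sum fun j _ => ?_
    have hPo : ∀ i, Po i = Pw i + p (S i) := fun i => by linarith [hcap i]
    rw [mul_left_comm, hPo i, hPo j]
    exact mul_le_mul_of_nonneg_left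
      (globalPressure_sq_le hw ho hη hwo hp hA (S i) (S j) (Pw i) (Pw j)) (hc i j)
  have hE0 : 0 ≤ E := Finset.sum_nonneg fun i _ => Finset.sum_nonneg fun j _ =>
    mul_nonneg (hc i j) (add_nonneg (mul_nonneg (hw _) (sq_nonneg _))
      (mul_nonneg (ho _) (sq_nonneg _)))
  have hN : (4 * l)⁻¹ * N2 ≤ 1 / 4 * E := by
    have h1 : N2 ≤ l * E := by
      calc N2 ≤ C * ∑ i, ∑ j, c i j * (Pw i + A (S i) - (Pw j + A (S j))) ^ 2 := hk
        _ ≤ C * (E / η) := by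
            gcongr
            rwa [le_div_iff₀ hη, mul_comm]
        _ ≤ (C + 1) * (E / η) := by
            gcongr
            linarith
        _ = l * E := by rw [hl]; ring
    rw [inv_mul_le_iff₀ (by positivity)]
    linarith
  -- E/2 on the left minus E/4 absorbed leaves E/4, hence the factor 4.
  have hfin : E ≤ 4 * ((2 * l + 2 * P) * (∑ i, μ i * q i ^ 2 + ∑ i, μ i * q' i ^ 2) +
      4 * P * (∑ i, μ i) - τ⁻¹ * (∑ i, ν i * G (S i) - ∑ i, ν i * G (S' i))) := by
    linarith
  refine (mul_le_mul_of_nonneg_left hfin hτ.le).trans (le_of_eq ?_)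
  field_simp

/-! ### Clamped functions -/

theorem clamp_mem (s : ℝ) : max 0 (min s 1) ∈ Icc (0 : ℝ) 1 :=
  ⟨le_max_left _ _, max_le zero_le_one (min_le_right _ _)⟩

theorem clamp_mono : Monotone fun s : ℝ => max 0 (min s 1) := fun _ _ h =>
  max_le_max le_rfl (min_le_min h le_rfl)

theorem clampExt_monotone {f : ℝ → ℝ} (hf : MonotoneOn f (Icc 0 1)) : Monotone (clampExt f) :=
  fun _ _ h => hf (clamp_mem _) (clamp_mem _) (clamp_mono h)

theorem clampExt_antitone {f : ℝ → ℝ} (hf : AntitoneOn f (Icc 0 1)) : Antitone (clampExt f) :=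
  fun _ _ h => hf (clamp_mem _) (clamp_mem _) (clamp_mono h)

theorem clampExt_continuous {f : ℝ → ℝ} (hf : ContinuousOn f (Icc 0 1)) :
    Continuous (clampExt f) :=
  hf.comp_continuous (f := fun s : ℝ => max 0 (min s 1)) (by fun_prop) clamp_mem

theorem fractional_antitone {w o : ℝ → ℝ} (hw : Monotone w) (ho : Antitone o)
    (hw0 : ∀ s, 0 ≤ w s) (ho0 : ∀ s, 0 ≤ o s) (hpos : ∀ s, 0 < w s + o s) :
    Antitone fun s => o s / (w s + o s) := by
  intro s t hst
  simp only
  rw [div_le_div_iff₀ (hpos t) (hpos s)]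
  nlinarith [mul_le_mul (ho hst) (hw hst) (hw0 s) (ho0 s)]

/-! ### The energy estimate -/

/-- At the last node the wetting phase equation follows from the other ones. -/
theorem IsDiscreteSolution.wetting_all {d : ℕ} {D : Data d} {m : Mesh d D.Ω} {N : ℕ}
    {S Pw Po : ℕ → Fin m.M → ℝ} (h : IsDiscreteSolution D m N S Pw Po) {n : ℕ}
    (hn : n ∈ Finset.Icc 1 N)
    (hbal : ∑ i, m.mass i * timeMean (D.T / N) (fun t => m.rhCorr (D.qIn t) i) n =
      ∑ i, m.mass i * timeMean (D.T / N) (fun t => m.rhCorr (D.qOut t) i) n) (i : Fin m.M) :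
    m.massW D.φ i / (D.T / N) * (S n i - S (n - 1) i)
      - ∑ j, m.c i j * clampExt D.ηw (upwindW (S n i) (S n j) (Pw n i) (Pw n j))
          * (Pw n j - Pw n i)
    = m.mass i *
      (clampExt D.fw (timeMean (D.T / N) (fun t => m.rh (D.sIn t) i) n)
          * timeMean (D.T / N) (fun t => m.rhCorr (D.qIn t) i) n
        - clampExt D.fw (S n i) * timeMean (D.T / N) (fun t => m.rhCorr (D.qOut t) i) n) := by
  have hkw := sum_flux_eq_zero
    (k := fun i j => m.c i j * clampExt D.ηw (upwindW (S n i) (S n j) (Pw n i) (Pw n j)))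
    (fun i j => by rw [m.c_comm, upwindW_comm]) (Pw n)
  have hko := sum_flux_eq_zero
    (k := fun i j => m.c i j * clampExt D.ηo (upwindO (S n i) (S n j) (Po n i) (Po n j)))
    (fun i j => by rw [m.c_comm, upwindO_comm]) (Po n)
  have hO := Finset.sum_congr rfl fun i (_ : i ∈ Finset.univ) => h.nonwetting n hn i
  rw [Finset.sum_sub_distrib, hko, sub_zero] at hO
  rw [← sub_eq_zero]
  -- The residuals of the wetting equation sum to zero: fluxes cancel, f_w + f_o = 1, and the summed
  -- non-wetting equation combines with the balance of the sources.
  refine eq_zero_of_sum_eq_zero (R := fun i => _) (fun i hi => sub_eq_zero.2 (h.wetting n hn i hi))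
    ?_ i
  rw [Finset.sum_sub_distrib, Finset.sum_sub_distrib, hkw, sub_zero, sub_eq_zero]
  have hfo : ∀ s, clampExt D.fo s = 1 - clampExt D.fw s := fun _ => rfl
  simp_rw [hfo] at hO
  rw [← sub_eq_zero, ← Finset.sum_sub_distrib] at hbal hO ⊢
  refine Eq.trans ?_ ((congrArg₂ (fun x y : ℝ => -x - y) hO hbal).trans (by simp))
  simp only [← Finset.sum_neg_distrib]
  rw [← Finset.sum_sub_distrib]
  exact Finset.sum_congr rfl fun i _ => by ring

/-- Sum `step_energy_le` over the time steps. The capillary energy telescopes to its initial value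
minus a nonnegative final value, and every other term is bounded by the data uniformly in the mesh
and the time step. -/
theorem exists_energy_bound {d : ℕ} {D : Data d} (hD : D.Admissible) :
    ∃ C : ℝ, ∀ (m : Mesh d D.Ω) (N : ℕ), 1 ≤ N → ∀ S Pw Po : ℕ → Fin m.M → ℝ,
      IsDiscreteSolution D m N S Pw Po →
      (D.T / N) * ∑ n ∈ Finset.Icc 1 N, ∑ i, ∑ j,
        m.c i j *
          (clampExt D.ηw (upwindW (S n i) (S n j) (Pw n i) (Pw n j)) * (Pw n i - Pw n j) ^ 2
            + clampExt D.ηo (upwindO (S n i) (S n j) (Po n i) (Po n j)) * (Po n i - Po n j) ^ 2)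
        ≤ C := by
  have hT := hD.T_pos
  have hΩ := hD.volume_frontier
  obtain ⟨φmin, φmax, hφmin, hφ⟩ := hD.porosity
  have hφ' : ∀ᵐ x ∂(volume.restrict D.Ω), 0 ≤ D.φ x ∧ D.φ x ≤ φmax :=
    hφ.mono fun x hx => ⟨hφmin.le.trans hx.1, hx.2⟩
  obtain ⟨η, hη, hwo'⟩ := hD.mobility_lower
  obtain ⟨Cp, hCp, hpoinc⟩ := exists_discrete_poincare hD.isOpen hD.isConnected hD.isBounded
    hD.lipschitz
  set w := clampExt D.ηw with hw
  set o := clampExt D.ηo with ho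
  set p := clampExt D.pc with hp
  have hw0 : ∀ s, 0 ≤ w s := fun s => hD.ηw_nonneg _ (clamp_mem s)
  have ho0 : ∀ s, 0 ≤ o s := fun s => hD.ηo_nonneg _ (clamp_mem s)
  have hwo : ∀ s, η ≤ w s + o s := fun s => hwo' _ (clamp_mem s)
  have hpos : ∀ s, 0 < w s + o s := fun s => hη.trans_le (hwo s)
  have hpanti : Antitone p := clampExt_antitone hD.pc_strictAnti.antitoneOn
  have hpcont : Continuous p := clampExt_continuous hD.pc_cont
  set P := |D.pc 0| + |D.pc 1| with hP
  have hpP : ∀ s, |p s| ≤ P := by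
    intro s
    have h0 : p s ≤ D.pc 0 := hD.pc_strictAnti.antitoneOn (by simp) (clamp_mem s) (clamp_mem s).1
    have h1 : D.pc 1 ≤ p s := hD.pc_strictAnti.antitoneOn (clamp_mem s) (by simp) (clamp_mem s).2
    rw [abs_le, hP]
    constructor <;>
      linarith [abs_nonneg (D.pc 0), abs_nonneg (D.pc 1), le_abs_self (D.pc 0),
        neg_abs_le (D.pc 1)]
  obtain ⟨A, hA0, hA⟩ := exists_stieltjes_integral
    (fractional_antitone (clampExt_monotone hD.ηw_mono) (clampExt_antitone hD.ηo_anti) hw0 ho0 hpos)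
    hpanti hpcont
  -- With κ = p(1/2), the integrand κ - p is nonpositive to the left of 1/2 and nonnegative to its
  -- right, so G attains its minimum 0 at 1/2.
  obtain ⟨G, hG0, hG⟩ := exists_primitive_le hpanti hpcont (p (1 / 2))
  have hfo : ∀ s, o s / (w s + o s) ∈ Icc (0 : ℝ) 1 := fun s =>
    ⟨div_nonneg (ho0 s) (hpos s).le, (div_le_one (hpos s)).2 (by linarith [hw0 s])⟩
  have hfw : ∀ s, clampExt D.fw s ∈ Icc (0 : ℝ) 1 := fun s =>
    ⟨div_nonneg (hw0 s) (hpos s).le, (div_le_one (hpos s)).2 (le_add_of_nonneg_right (ho0 s))⟩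
  -- As f_o lies in [0,1], A varies no more than p, and A(0) = 0.
  have hAP : ∀ s, |A s| ≤ 2 * P := by
    intro s
    have hs := abs_le.1 (hpP s)
    have h0 := abs_le.1 (hpP 0)
    rw [abs_le]
    rcases le_total s 0 with h | h
    · obtain ⟨h1, h2⟩ := hA s 0 h
      have h3 := sub_nonneg.2 (hpanti h)
      constructor <;> nlinarith [(hfo s).1, (hfo s).2, (hfo 0).1, (hfo 0).2]
    · obtain ⟨h1, h2⟩ := hA 0 s h
      have h3 := sub_nonneg.2 (hpanti h)
      constructor <;> nlinarith [(hfo s).1, (hfo s).2, (hfo 0).1, (hfo 0).2]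
  have hGnn : ∀ s, 0 ≤ G s := fun s => by
    have := hG (1 / 2) s
    rw [hG0, sub_self, zero_mul] at this
    linarith
  -- This bound is applied to the initial saturation only.
  have hGle : ∀ s ∈ Icc (0 : ℝ) 1, G s ≤ 2 * P := fun s hs => by
    have h1 := hG s (1 / 2)
    have h2 := abs_le.1 (hpP s)
    have h3 := abs_le.1 (hpP (1 / 2))
    have h4 : (p (1 / 2) - p s) * (s - 1 / 2) ≤ 2 * P := by
      refine (le_abs_self _).trans ?_
      rw [abs_mul]
      have h5 : |p (1 / 2) - p s| ≤ 2 * P := abs_le.2 ⟨by linarith, by linarith⟩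
      have h6 : |s - 1 / 2| ≤ 1 := abs_le.2 ⟨by linarith [hs.1], by linarith [hs.2]⟩
      nlinarith [abs_nonneg (p (1 / 2) - p s), abs_nonneg (s - 1 / 2)]
    linarith
  set Qi := ∫ t in (0 : ℝ)..D.T, ∫ x in D.Ω, D.qIn t x ^ 2 with hQi
  set Qo := ∫ t in (0 : ℝ)..D.T, ∫ x in D.Ω, D.qOut t x ^ 2 with hQo
  refine ⟨4 * ((2 * ((Cp + 1) / η) + 2 * P) * (Qi + Qo) + 4 * P * volume.real D.Ω * D.T +
    φmax * volume.real D.Ω * (2 * P)), fun m N hN S Pw Po hS => ?_⟩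
  have hN0 : (0 : ℝ) < N := by exact_mod_cast hN
  set τ := D.T / N with hτ
  have hτ0 : 0 < τ := by positivity
  have hP0 : 0 ≤ P := by positivity
  have hν := m.massW_nonneg hΩ hφ'
  set q : ℕ → Fin m.M → ℝ := fun n i => timeMean τ (fun t => m.rhCorr (D.qIn t) i) n with hq
  set q' : ℕ → Fin m.M → ℝ := fun n i => timeMean τ (fun t => m.rhCorr (D.qOut t) i) n with hq'
  set 𝒢 : ℕ → ℝ := fun n => ∑ i, m.massW D.φ i * G (S n i) with h𝒢
  have hstep : ∀ n ∈ Finset.Icc 1 N, τ * (∑ i, ∑ j, m.c i j *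
      (w (upwindW (S n i) (S n j) (Pw n i) (Pw n j)) * (Pw n i - Pw n j) ^ 2
        + o (upwindO (S n i) (S n j) (Po n i) (Po n j)) * (Po n i - Po n j) ^ 2)) ≤
      4 * ((2 * ((Cp + 1) / η) + 2 * P) *
          (τ * ∑ i, m.mass i * q n i ^ 2 + τ * ∑ i, m.mass i * q' n i ^ 2) +
        4 * P * (∑ i, m.mass i) * τ - (𝒢 n - 𝒢 (n - 1))) := by
    intro n hn
    have hbal : ∑ i, m.mass i * q n i = ∑ i, m.mass i * q' n i := by
      rw [hq, hq', hτ]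
      simp only
      rw [hD.sum_mass_timeMean m hD.qIn_L2 hn, hD.sum_mass_timeMean m hD.qOut_L2 hn]
      exact timeMean_congr (by positivity) (ae_mono (restrict_step_le hT hn) hD.q_balance)
    exact step_energy_le (κ := p (1 / 2)) m.c_nonneg m.c_comm (fun i => (m.mass_pos i).le) hν hτ0
      hw0 ho0 hη hwo hpanti hpP (hpP _) hA hAP hG
      (fun i => hfw (timeMean τ (fun t => m.rh (D.sIn t) i) n)) (fun i => hfw (S n i)) hbal hCp
      (hpoinc m) (hS.wetting_all hn hbal) (hS.nonwetting n hn) (hS.capillary n hn)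
  have htel : ∑ n ∈ Finset.Icc 1 N, (𝒢 n - 𝒢 (n - 1)) = 𝒢 N - 𝒢 0 := by
    rw [sum_Icc_one]
    simp only [add_tsub_cancel_right]
    exact Finset.sum_range_sub 𝒢 N
  have h𝒢N : 0 ≤ 𝒢 N := Finset.sum_nonneg fun i _ => mul_nonneg (hν i) (hGnn _)
  have h𝒢0 : 𝒢 0 ≤ φmax * volume.real D.Ω * (2 * P) := by
    refine le_trans ?_ (mul_le_mul_of_nonneg_right (m.sum_massW_le hΩ hφ') (by positivity))
    rw [Finset.sum_mul]
    refine Finset.sum_le_sum fun i _ => mul_le_mul_of_nonneg_left (hGle _ ?_) (hν i)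
    rw [hS.init i]
    exact m.rh_mem_Icc hΩ hD.isBounded hD.s0_meas hD.s0_mem i
  have hqi := hD.sum_timeMean_sq_le m hD.qIn_L2 hN
  have hqo := hD.sum_timeMean_sq_le m hD.qOut_L2 hN
  rw [Finset.mul_sum] at hqi hqo
  have hNτ : (N : ℝ) * τ = D.T := by rw [hτ]; field_simp
  rw [Finset.mul_sum]
  refine (Finset.sum_le_sum hstep).trans ?_
  rw [← Finset.mul_sum, Finset.sum_sub_distrib, Finset.sum_add_distrib, ← Finset.mul_sum,
    Finset.sum_add_distrib, htel, Finset.sum_const, Nat.card_Icc, nsmul_eq_mul,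
    m.sum_mass hΩ, add_tsub_cancel_right, mul_left_comm, hNτ]
  have hK : 0 ≤ 2 * ((Cp + 1) / η) + 2 * P := by positivity
  have := mul_le_mul_of_nonneg_left (add_le_add hqi hqo) hK
  linarith

end

end TwoPhase

theorem mainTheorem5 (d : ℕ) (hd : d = 2 ∨ d = 3) (D : TwoPhase.Data d) (hD : D.Admissible)
    (σ : ℝ) :
    ∃ C : ℝ, ∀ m : TwoPhase.Mesh d D.Ω,
      m.ShapeRegular σ → m.NonObtuse → m.ConstantOnElements D.φ →
      ∀ N : ℕ, 1 ≤ N → ∀ S Pw Po : ℕ → Fin m.M → ℝ,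
        TwoPhase.IsDiscreteSolution D m N S Pw Po →
        (D.T / N) * ∑ n ∈ Finset.Icc 1 N, ∑ i, ∑ j,
          m.c i j *
            (TwoPhase.clampExt D.ηw (TwoPhase.upwindW (S n i) (S n j) (Pw n i) (Pw n j))
                * (Pw n i - Pw n j) ^ 2
              + TwoPhase.clampExt D.ηo (TwoPhase.upwindO (S n i) (S n j) (Po n i) (Po n j))
                * (Po n i - Po n j) ^ 2)
          ≤ C := by
  obtain ⟨C, hC⟩ := TwoPhase.exists_energy_bound hD
  exact ⟨C, fun m _ _ _ N hN S Pw Po hS => hC m N hN S Pw Po hS⟩
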